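/- Let $d\ge 1$, $p\ge 1$ and $\varrho>0$. There is $\eta_0>0$, depending only on $d,p,\varrho$, such that for every $\eta>\eta_0$ there is a constant $C_\eta>0$, depending only on $d,p,\varrho,\eta$, with the following property. **Mesh.** Let $\Omega\subset\mathbb R^d$ be the interior of its closure (e.g. a bounded Lipschitz domain), and let $\mathcal T_h=\{K_e\}$ be any finite decomposition of $\bar\Omega$ into convex polytopes with nonempty, pairwise disjoint interiors (hanging nodes are allowed), with $h_e=\operatorname{diam}K_e$, that is shape regular with parameter $\varrho$: each $K_e$ contains a ball of radius $\varrho h_e$. Let $V_h^d$ be the space of broken polynomials $v_h$ with $v_h|_{K_e}\in V_h(K_e)$, where each $V_h(K_e)$ is $\mathbb P_p$ (total degree at most $p$) or $\mathbb Q_p$ (degree at most $p$ in each variable). The set $\mathcal F$ of faces consists of the interfaces (the parts of facets shared by two elements $K^+,K^-$) and the boundary faces (the parts of facets on $\partial\Omega$, with adjacent element $K^+$) of positive $(d-1)$-dimensional measure; $h_F=\operatorname{diam}F$ if $d\ge2$, and $h_F$ is the smallest diameter of the elements adjacent to $F$ if $d=1$. **Data.** Let $\varepsilon>0$, let $\mathbf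 b\in W^{1,\infty}(\Omega)^d$ be represented by a function that is continuous on $\bar\Omega$, let $c\in L^\infty(\Omega)$ with $c\ge0$, and let $\sigma_0>0$ be such that $c-\tfrac12\nabla\cdot\mathbf b\ge\sigma_0$ a.e. in $\Omega$. **Forms.** On a face put $\{\!\{\nabla v\}\!\}=\frac12(\nabla v|_{K^+}+\nabla v|_{K^-})$, $[\![v]\!]=v|_{K^+}\mathbf n_{K^+}+v|_{K^-}\mathbf n_{K^-}$ and $[\mathbf b v]^\uparrow=\mathbf b\,v|_{K^+}$ where $\mathbf b\cdot\mathbf n_{K^+}\ge0$, $[\mathbf b v]^\uparrow=\mathbf b\,v|_{K^-}$ elsewhere. On boundary faces $\mathbf n_{K^-}=-\mathbf n_{K^+}$, $\nabla v|_{K^-}$ is replaced by $\nabla v|_{K^+}$ in the average, and $v|_{K^-}$ by $0$ in the jump and in the upwind value. Let $$\begin{aligned}a(v,w)={}&\varepsilon\Big[\sum_e(\nabla w,\nabla v)_{K_e}-\sum_{F\in\mathcal F}\int_F\Big(\{\!\{\nabla w\}\!\}\cdot[\![v]\!]+\{\!\{\nabla v\}\!\}\cdot[\![w]\!]-\frac{\eta}{h_F}[\![w]\!]\cdot[\![v]\!]\Big)d\sigma\Big]\\&-\sum_e(v,\mathbf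 b\cdot\nabla w)_{K_e}+\sum_{F\in\mathcal F}\int_F[\mathbf b v]^\uparrow\cdot[\![w]\!]\,d\sigma+((c-\nabla\cdot\mathbf b)v,w)_\Omega .\end{aligned}$$ Let $\gamma_e:V_h^d\to[0,1]$ be arbitrary blending factors, $\nu_e=\|\mathbf b\|_{L^\infty(K_e)}h_e/(2p)$, and $\kappa(\nabla v)=\nabla v-P_h\nabla v$ with $P_h$ the componentwise $L^2(\Omega)$-orthogonal projection onto $V_h^d$. Let $$d_h(u;v,w)=\sum_e\Big(\gamma_e(u)\,\nu_e\,(\kappa(\nabla w),\kappa(\nabla v))_{K_e}+(1-\gamma_e(u))\,\nu_e\,(\nabla w,\nabla v)_{K_e}\Big),$$ $$\|v\|_{DG}^2=\varepsilon\Big[\sum_e\|\nabla v\|_{0,K_e}^2+\sum_{F\in\mathcal F}\frac1{h_F}\|[\![v]\!]\|_{0,F}^2\Big]+\sigma_0\|v\|_{0,\Omega}^2 .$$ **Claim.** For all $v_h,w_h\in V_h^d$, $$a(v_h,v_h)+d_h(w_h;v_h,v_h)\ \ge\ C_\eta\,\|v_h\|_{DG}^2 .$$ In particular, neither $\eta_0$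 nor $C_\eta$ depends on $\varepsilon$, on the data $\Omega,\mathbf b,c,\sigma_0$, on $\gamma_e$, or on the mesh, beyond the regularity parameter $\varrho$. -/

import Mathlib

open MeasureTheory
open scoped ENNReal ContDiff

noncomputable section

namespace DGWeno

/-- Euclidean space `ℝ^d`. -/
abbrev E (d : ℕ) : Type := EuclideanSpace ℝ (Fin d)

/-! ### Coefficients: weak derivatives and `W^{1,∞}` -/

/-- `g` is a weak `i`-th partial derivative of `f` on the open set `Ω`. -/
def HasWeakPartial {d : ℕ} (Ω : Set (E d)) (i : Fin d) (f g : E d → ℝ) : Prop :=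
  ∀ φ : E d → ℝ, ContDiff ℝ ∞ φ → HasCompactSupport φ → tsupport φ ⊆ Ω →
    ∫ x in Ω, f x * fderiv ℝ φ x (EuclideanSpace.single i 1) = - ∫ x in Ω, g x * φ x

/-- `f ∈ L^∞(Ω)`. -/
def MemLInf {d : ℕ} (Ω : Set (E d)) (f : E d → ℝ) : Prop :=
  MemLp f ∞ (volume.restrict Ω)

/-- `f ∈ W^{1,∞}(Ω)`. -/
def MemW1Inf {d : ℕ} (Ω : Set (E d)) (f : E d → ℝ) : Prop :=
  MemLInf Ω f ∧ ∀ i, ∃ g, MemLInf Ω g ∧ HasWeakPartial Ω i f g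

open Classical in
/-- The weak `i`-th partial derivative in `L^∞(Ω)` (unique up to null sets; `0` if there is
none). -/
def weakPartial {d : ℕ} (Ω : Set (E d)) (i : Fin d) (f : E d → ℝ) : E d → ℝ :=
  if h : ∃ g, MemLInf Ω g ∧ HasWeakPartial Ω i f g then h.choose else 0

/-- The weak divergence `∇ · b`. -/
def weakDiv {d : ℕ} (Ω : Set (E d)) (b : E d → E d) (x : E d) : ℝ :=
  ∑ i, weakPartial Ω i (fun y => b y i) x

/-! ### Meshes -/

/-- A convex polytope with nonempty interior, as a bounded intersection of finitely many
half-spaces `⟪n, x⟫ ≤ offset n` with distinct unit normals `n`. -/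
structure Polytope (d : ℕ) where
  normals : Finset (E d)
  offset : E d → ℝ
  norm_eq_one : ∀ n ∈ normals, ‖n‖ = 1
  bounded : Bornology.IsBounded {x : E d | ∀ n ∈ normals, inner ℝ n x ≤ offset n}
  nonempty_interior : (interior {x : E d | ∀ n ∈ normals, inner ℝ n x ≤ offset n}).Nonempty

namespace Polytope

variable {d : ℕ} (K : Polytope d)

/-- The closed polytope as a set. -/
def carrier : Set (E d) := {x | ∀ n ∈ K.normals, inner ℝ n x ≤ K.offset n}

/-- The part of the boundary of the polytope that lies in the hyperplane with normal `n`. For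
`n ∈ K.normals` this is the facet with outer unit normal `n` (a null set for the surface measure
if the corresponding inequality is redundant). -/
def facet (n : E d) : Set (E d) := {x ∈ K.carrier | inner ℝ n x = K.offset n}

/-- The diameter `h_K`. -/
def diam : ℝ := Metric.diam K.carrier

end Polytope

/-- A decomposition of (the closure of) `Ω` into finitely many non-overlapping convex polytopes.
Hanging nodes are allowed. -/
structure Mesh (d : ℕ) (Ω : Set (E d)) where
  numCells : ℕ
  cell : Fin numCells → Polytope d
  disjoint : ∀ e e', e ≠ e' →
    Disjoint (interior (cell e).carrier) (interior (cell e').carrier)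
  iUnion_eq : ⋃ e, (cell e).carrier = closure Ω

/-- An oriented face candidate: `⟨(e, s), n⟩` stands for the part of the facet of the cell
`K⁺ = K_e` with outer normal `n` that is shared with the cell `K⁻ = K_{e'}` if `s = some e'`,
and that lies on `∂Ω` if `s = none`. -/
abbrev Face (d N : ℕ) : Type := (_ : Fin N × Option (Fin N)) × E d

namespace Face

variable {d N : ℕ} (F : Face d N)

/-- The index of `K⁺`. -/
def plus : Fin N := F.1.1

/-- The index of `K⁻` (`none` on the boundary of the domain). -/
def minus : Option (Fin N) := F.1.2

/-- The unit normal `n_{K⁺}`; one has `n_{K⁻} = -n_{K⁺}`. -/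
def normal : E d := F.2

end Face

/-- The kind of the local polynomial space: `ℙ_p` or `ℚ_p`. -/
inductive SpaceKind
  | P
  | Q

/-- `ℙ_p` (total degree at most `p`) or `ℚ_p` (degree at most `p` in each variable). -/
def localSpace (d p : ℕ) : SpaceKind → Submodule ℝ (MvPolynomial (Fin d) ℝ)
  | .P => MvPolynomial.restrictTotalDegree (Fin d) ℝ p
  | .Q => MvPolynomial.restrictDegree (Fin d) ℝ p

/-- The value of a polynomial at a point. -/
def val {d : ℕ} (q : MvPolynomial (Fin d) ℝ) (x : E d) : ℝ :=
  MvPolynomial.eval (fun i => x i) q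

/-- The gradient of a polynomial. -/
def grad {d : ℕ} (q : MvPolynomial (Fin d) ℝ) (x : E d) : E d :=
  WithLp.toLp 2 fun i => val (MvPolynomial.pderiv i q) x

/-- `grad` is the gradient of `val`. -/
theorem hasGradientAt_val {d : ℕ} (q : MvPolynomial (Fin d) ℝ) (x : E d) :
    HasGradientAt (val q) (grad q x) x := by
  rw [hasGradientAt_iff_hasFDerivAt]
  induction q using MvPolynomial.induction_on with
  | C a =>
    have h1 : val (MvPolynomial.C a : MvPolynomial (Fin d) ℝ) = fun _ => a := by
      funext y; simp [val]
    have h2 : grad (MvPolynomial.C a : MvPolynomial (Fin d) ℝ) x = 0 := by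
      ext i; simp [grad, val]
    rw [h1, h2, map_zero]
    exact hasFDerivAt_const a x
  | add q r hq hr =>
    have h1 : val (q + r) = fun y => val q y + val r y := by funext y; simp [val]
    have h2 : grad (q + r) x = grad q x + grad r x := by ext i; simp [grad, val]
    rw [h1, h2, map_add]
    exact hq.add hr
  | mul_X q i hq =>
    have h1 : val (q * MvPolynomial.X i) = fun y => val q y * y i := by funext y; simp [val]
    have h2 : grad (q * MvPolynomial.X i) x
        = val q x • EuclideanSpace.single i (1 : ℝ) + x i • grad q x := by
      ext j
      by_cases hij : i = j
      · subst hij; simp [grad, val]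
      · have hji : j ≠ i := fun h => hij h.symm
        simp [grad, val, hji]
    have h3 : HasFDerivAt (fun y : E d => y i) (EuclideanSpace.proj i : E d →L[ℝ] ℝ) x :=
      (EuclideanSpace.proj i : E d →L[ℝ] ℝ).hasFDerivAt
    have h4 : InnerProductSpace.toDual ℝ (E d)
          (val q x • EuclideanSpace.single i (1 : ℝ) + x i • grad q x)
        = val q x • (EuclideanSpace.proj i : E d →L[ℝ] ℝ)
          + x i • InnerProductSpace.toDual ℝ (E d) (grad q x) := by
      ext y
      rw [InnerProductSpace.toDual_apply_apply]
      simp [inner_add_left, inner_smul_left, EuclideanSpace.inner_single_left]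
    rw [h1, h2, h4]
    exact hq.mul h3

/-- A broken polynomial: one polynomial per cell. Since the cells have nonempty interior, this is
the same as a function on the union of the cell interiors that is polynomial on each of them. -/
abbrev Broken (d N : ℕ) : Type := Fin N → MvPolynomial (Fin d) ℝ

/-- The broken space `V_h^d(𝒯_h)`; the local space may be `ℙ_p` or `ℚ_p`. -/
def brokenSpace (d p : ℕ) {N : ℕ} (kind : Fin N → SpaceKind) : Submodule ℝ (Broken d N) :=
  Submodule.pi Set.univ fun e => localSpace d p (kind e)

namespace Mesh

variable {d : ℕ} {Ω : Set (E d)} (M : Mesh d Ω)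

/-- The closed element `K_e`. -/
def K (e : Fin M.numCells) : Set (E d) := (M.cell e).carrier

/-- The element diameter `h_e`. -/
def h (e : Fin M.numCells) : ℝ := (M.cell e).diam

/-- Shape regularity with parameter `ϱ`: each `K_e` contains a ball of radius `ϱ h_e`. -/
def ShapeRegular (ϱ : ℝ) : Prop :=
  ∀ e, ∃ x, Metric.ball x (ϱ * M.h e) ⊆ M.K e

/-- The point set of a face. -/
def faceSet (F : Face d M.numCells) : Set (E d) :=
  (M.cell F.plus).facet F.normal ∩
    match F.minus with
    | none => frontier Ω
    | some e' => M.K e'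

open Classical in
/-- The set `ℱ` of mesh faces: all interfaces (each listed once, oriented from the smaller to the
larger cell index) and all boundary faces, of positive surface measure. -/
def faces : Finset (Face d M.numCells) :=
  ((Finset.univ : Finset (Fin M.numCells × Option (Fin M.numCells))).sigma
    fun q => (M.cell q.1).normals).filter fun F =>
      (∀ e', F.minus = some e' → F.plus < e') ∧
        0 < (Measure.euclideanHausdorffMeasure (d - 1) : Measure (E d)) (M.faceSet F)

/-- The integral over a face with respect to the surface measure `dσ`, that is, the
`(d-1)`-dimensional Hausdorff measure, normalized as Lebesgue measure on hyperplanes. -/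
def faceIntegral (F : Face d M.numCells) (f : E d → ℝ) : ℝ :=
  ∫ x in M.faceSet F, f x ∂(Measure.euclideanHausdorffMeasure (d - 1))

/-- The local length scale `h_F`: the diameter of `F` if `d ≥ 2`; in dimension one, where faces
are points, the smallest diameter of the adjacent elements. -/
def hF (F : Face d M.numCells) : ℝ :=
  if d = 1 then
    match F.minus with
    | none => M.h F.plus
    | some e' => min (M.h F.plus) (M.h e')
  else Metric.diam (M.faceSet F)

variable {M}

/-- The trace `v|_{K⁻}` in jumps and upwind values; it is zero on `∂Ω`. -/
def valMinus (F : Face d M.numCells) (v : Broken d M.numCells) (x : E d) : ℝ :=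
  match F.minus with
  | none => 0
  | some e' => val (v e') x

/-- The trace `∇v|_{K⁻}` in averages; it is replaced by `∇v|_{K⁺}` on `∂Ω`. -/
def gradMinus (F : Face d M.numCells) (v : Broken d M.numCells) (x : E d) : E d :=
  match F.minus with
  | none => grad (v F.plus) x
  | some e' => grad (v e') x

/-- The average of the gradient on a face. -/
def avgGrad (F : Face d M.numCells) (v : Broken d M.numCells) (x : E d) : E d :=
  (1 / 2 : ℝ) • (grad (v F.plus) x + gradMinus F v x)

/-- The (vector-valued) jump on a face. -/
def jump (F : Face d M.numCells) (v : Broken d M.numCells) (x : E d) : E d :=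
  val (v F.plus) x • F.normal + valMinus F v x • (-F.normal)

/-- The (vector-valued) upwind flux: `b v|_{K⁺}` if `b · n_{K⁺} ≥ 0` and `b v|_{K⁻}` otherwise. -/
def upw (F : Face d M.numCells) (b : E d → E d) (v : Broken d M.numCells) (x : E d) : E d :=
  (if 0 ≤ inner ℝ (b x) F.normal then val (v F.plus) x else valMinus F v x) • b x

variable (M)

/-- The DG bilinear form `a(v, w)`. -/
def dgForm (ε η : ℝ) (b : E d → E d) (c : E d → ℝ) (v w : Broken d M.numCells) : ℝ :=
  ε * ((∑ e, ∫ x in M.K e, inner ℝ (grad (w e) x) (grad (v e) x))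
      - (∑ F ∈ M.faces, M.faceIntegral F fun x =>
          inner ℝ (avgGrad F w x) (jump F v x) + inner ℝ (avgGrad F v x) (jump F w x)
            - η / M.hF F * inner ℝ (jump F w x) (jump F v x)))
    - (∑ e, ∫ x in M.K e, val (v e) x * inner ℝ (b x) (grad (w e) x))
    + (∑ F ∈ M.faces, M.faceIntegral F fun x => inner ℝ (upw F b v x) (jump F w x))
    + (∑ e, ∫ x in M.K e, (c x - weakDiv Ω b x) * val (v e) x * val (w e) x)

/-- `q` is the `L²(Ω)`-orthogonal projection onto the space `V` of broken polynomials of the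
function that equals `f e` on `K_e`. -/
def IsL2Proj (V : Submodule ℝ (Broken d M.numCells)) (f : Fin M.numCells → E d → ℝ)
    (q : Broken d M.numCells) : Prop :=
  q ∈ V ∧ ∀ φ ∈ V, ∑ e, ∫ x in M.K e, (f e x - val (q e) x) * val (φ e) x = 0

open Classical in
/-- The `L²(Ω)`-orthogonal projection onto the space `V` of broken polynomials. -/
def l2Proj (V : Submodule ℝ (Broken d M.numCells)) (f : Fin M.numCells → E d → ℝ) :
    Broken d M.numCells :=
  if h : ∃ q, M.IsL2Proj V f q then h.choose else 0

/-- The fluctuation `κ_e(∇v) = ∇v - P_h ∇v` on `K_e`, with the componentwise `L²` projection. -/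
def fluctGrad (V : Submodule ℝ (Broken d M.numCells)) (v : Broken d M.numCells)
    (e : Fin M.numCells) (x : E d) : E d :=
  WithLp.toLp 2 fun i =>
    grad (v e) x i - val (M.l2Proj V (fun e' y => grad (v e') y i) e) x

/-- The artificial viscosity `ν_e = λ_e h_e / (2 p)` with `λ_e = ‖b‖_{L^∞(K_e)}`. -/
def visc (p : ℕ) (b : E d → E d) (e : Fin M.numCells) : ℝ :=
  (eLpNorm b ∞ (volume.restrict (M.K e))).toReal * M.h e / (2 * p)

/-- The nonlinear stabilization `d_h(u; v, w)`: the blend, with the blending factors `γ_e(u)`, of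
the high-order stabilization (fluctuations of the gradients) and the low-order one. -/
def stab (p : ℕ) (kind : Fin M.numCells → SpaceKind) (b : E d → E d)
    (γ : Fin M.numCells → Broken d M.numCells → ℝ) (u v w : Broken d M.numCells) : ℝ :=
  ∑ e, (γ e u * M.visc p b e * (∫ x in M.K e,
            inner ℝ (M.fluctGrad (brokenSpace d p kind) w e x)
              (M.fluctGrad (brokenSpace d p kind) v e x))
        + (1 - γ e u) * M.visc p b e *
            (∫ x in M.K e, inner ℝ (grad (w e) x) (grad (v e) x)))

/-- The squared norm `‖v‖²_DG`. -/
def dgNormSq (ε σ₀ : ℝ) (v : Broken d M.numCells) : ℝ :=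
  ε * ((∑ e, ∫ x in M.K e, ‖grad (v e) x‖ ^ 2)
      + (∑ F ∈ M.faces, 1 / M.hF F * M.faceIntegral F fun x => ‖jump F v x‖ ^ 2))
    + σ₀ * (∑ e, ∫ x in M.K e, val (v e) x ^ 2)

end Mesh

end DGWeno

end

/-!
Coercivity rests on three facts about the mesh, whose constants see only `d`, `p` and `ϱ`.

*Divergence theorem on a polytope* (`Polytope.integral_mul_fderiv_add_eq_sum_facet`). The field is
only continuous with bounded weak derivatives, so the weak formulation is tested with a smooth
function times a cut-off, a product of one ramp per facet at scale `δ`. Fubini in the direction of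
a facet normal shows that the gradient of the cut-off concentrates, as `δ → 0`, on that facet
(`Polytope.tendsto_integral_layer`). This needs only Lebesgue measure in orthogonal coordinates,
and the fact that two non-parallel hyperplanes meet in a surface null set.

*Faces tile facets* (`Mesh.sum_faces_eq_sum_facets`). Off the null set of points in two
non-parallel facet hyperplanes, the cells look like half-spaces, so a point of a facet either lies
on `∂Ω` or belongs to exactly one further cell, which has the opposite facet there. Hence integrals
over the faces of the traces from both sides add up to integrals over the cell boundaries.

*Discrete trace inequality* (`exists_trace_const`). Equivalence of norms on polynomials of bounded
degree and scaling bound the maximum of `q²` on a cell by its mean over the inscribed ball. The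
divergence theorem for `x - x₀` bounds the perimeter by `d / (ϱ h)` times the volume. Together they
give `h ‖q‖²_{∂K} ≤ C ‖q‖²_K`.

With `η₀ = C`, Young's inequality with a parameter `t` such that `C < 1 / t < η` absorbs the
consistency terms into the gradients and the penalty (`Mesh.sum_faces_diffusion_le`). Integration by
parts turns the convective volume term into `½ (∇ · b) v²` minus half of the boundary integrals of
`(b · n) v²`. The upwind fluxes exceed those halves by `½ |b · n| ⟦v⟧²` on each face, so only
`c - ½ ∇ · b ≥ σ₀` remains (`Mesh.convection_reaction_ge`). The stabilization is nonnegative.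
-/

namespace DGWeno

open Filter Topology Module

/-! ### Surface measure on hyperplanes -/

/-- The surface measure on `ℝ^d`: the `(d-1)`-dimensional Hausdorff measure, normalized to be
Lebesgue measure on hyperplanes. -/
noncomputable abbrev surf (d : ℕ) : Measure (E d) := Measure.euclideanHausdorffMeasure (d - 1)

/-- The hyperplane `⟪n, x⟫ = a`. -/
def hyper {d : ℕ} (n : E d) (a : ℝ) : Set (E d) := {x | inner ℝ n x = a}

section Hyperplanes

variable {d : ℕ} {n : E d}

lemma isClosed_hyper (n : E d) (a : ℝ) : IsClosed (hyper n a) :=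
  isClosed_eq (by fun_prop) continuous_const

lemma inner_self_of_norm_one (hn : ‖n‖ = 1) : inner ℝ n n = (1 : ℝ) := by
  rw [real_inner_self_eq_norm_sq, hn, one_pow]

lemma inner_perp (y : (ℝ ∙ n)ᗮ) : inner ℝ n (y : E d) = (0 : ℝ) :=
  Submodule.mem_orthogonal_singleton_iff_inner_right.1 y.2

lemma inner_hyperMap (hn : ‖n‖ = 1) (y : (ℝ ∙ n)ᗮ) (a : ℝ) :
    inner ℝ n ((y : E d) + a • n) = a := by
  rw [inner_add_right, inner_perp, inner_smul_right, inner_self_of_norm_one hn]; simp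

lemma finrank_perp (hn : ‖n‖ = 1) : finrank ℝ (ℝ ∙ n)ᗮ = d - 1 := by
  have h := (ℝ ∙ n).finrank_add_finrank_orthogonal
  have hn0 : n ≠ 0 := by rintro rfl; simp at hn
  rw [finrank_span_singleton hn0, finrank_euclideanSpace_fin] at h
  omega

lemma isometry_hyperMap (n : E d) (a : ℝ) :
    Isometry fun y : (ℝ ∙ n)ᗮ => (y : E d) + a • n :=
  (isometry_add_right (a • n)).comp isometry_subtype_coe

lemma range_hyperMap (hn : ‖n‖ = 1) (a : ℝ) :
    Set.range (fun y : (ℝ ∙ n)ᗮ => (y : E d) + a • n) = hyper n a := by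
  ext x
  constructor
  · rintro ⟨y, rfl⟩
    exact inner_hyperMap hn y a
  · intro hx
    refine ⟨⟨x - a • n, ?_⟩, by simp⟩
    rw [Submodule.mem_orthogonal_singleton_iff_inner_right, inner_sub_right, inner_smul_right,
      inner_self_of_norm_one hn, show inner ℝ n x = a from hx]
    simp

lemma map_hyperMap (hn : ‖n‖ = 1) (a : ℝ) :
    (volume : Measure (ℝ ∙ n)ᗮ).map (fun y : (ℝ ∙ n)ᗮ => (y : E d) + a • n)
      = (surf d).restrict (hyper n a) := by
  rw [← InnerProductSpace.euclideanHausdorffMeasure_eq_volume, finrank_perp hn,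
    (isometry_hyperMap n a).map_euclideanHausdorffMeasure, range_hyperMap hn]

lemma measurableEmbedding_hyperMap (n : E d) (a : ℝ) :
    MeasurableEmbedding fun y : (ℝ ∙ n)ᗮ => (y : E d) + a • n :=
  (isometry_hyperMap n a).isClosedEmbedding.measurableEmbedding

lemma setIntegral_hyper (hn : ‖n‖ = 1) (a : ℝ) (f : E d → ℝ) :
    ∫ x in hyper n a, f x ∂(surf d) = ∫ y : (ℝ ∙ n)ᗮ, f ((y : E d) + a • n) := by
  rw [← map_hyperMap hn, (measurableEmbedding_hyperMap n a).integral_map]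

lemma isFiniteMeasureOnCompacts_surf_hyper (hn : ‖n‖ = 1) (a : ℝ) :
    IsFiniteMeasureOnCompacts ((surf d).restrict (hyper n a)) := by
  refine ⟨fun C hC => ?_⟩
  rw [← map_hyperMap hn, (measurableEmbedding_hyperMap n a).map_apply]
  exact ((isometry_hyperMap n a).isClosedEmbedding.isCompact_preimage hC).measure_lt_top

/-- Two non-parallel hyperplanes meet in a surface null set. -/
lemma surf_hyper_inter_hyper {m : E d} (hn : ‖n‖ = 1) (hm : ‖m‖ = 1) (h1 : m ≠ n) (h2 : m ≠ -n)
    (a b : ℝ) : surf d (hyper n a ∩ hyper m b) = 0 := by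
  rcases (hyper n a ∩ hyper m b).eq_empty_or_nonempty with he | ⟨p, hp⟩
  · rw [he, measure_empty]
  have hli : LinearIndependent ℝ ![n, m] := by
    refine LinearIndependent.pair_iff.2 fun s t hst => ?_
    by_cases ht : t = 0
    · have hn0 : n ≠ 0 := by rintro rfl; simp at hn
      subst ht
      simpa [hn0] using hst
    · exfalso
      have hmn : m = (-s / t) • n := by
        have : t • m = (-s) • n := by rw [neg_smul]; exact eq_neg_of_add_eq_zero_right hst
        rw [div_eq_inv_mul, mul_smul, ← this, smul_smul, inv_mul_cancel₀ ht, one_smul]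
      have hc : |(-s / t)| = 1 := by
        have := hm
        rwa [hmn, norm_smul, hn, mul_one, Real.norm_eq_abs] at this
      rcases eq_or_eq_neg_of_abs_eq hc with h | h
      · exact h1 (by rw [hmn, h, one_smul])
      · exact h2 (by rw [hmn, h, neg_smul, one_smul])
  set W : Submodule ℝ (E d) := Submodule.span ℝ (Set.range ![n, m]) with hW
  have hfr : finrank ℝ W = 2 := by
    have := finrank_span_eq_card hli
    simpa using this
  have hperp := W.finrank_add_finrank_orthogonal
  rw [hfr, finrank_euclideanSpace_fin] at hperp
  -- the intersection lies in a translate of a subspace of dimension `d - 2 < d - 1`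
  have hsub : hyper n a ∩ hyper m b ⊆ Set.range (fun y : Wᗮ => (y : E d) + p) := by
    intro x hx
    refine ⟨⟨x - p, ?_⟩, by simp⟩
    rw [Submodule.mem_orthogonal']
    intro u hu
    have : W ≤ LinearMap.ker (innerSL ℝ (x - p)).toLinearMap := by
      rw [hW, Submodule.span_le]
      rintro _ ⟨i, rfl⟩
      fin_cases i
      · have e1 : inner ℝ n x = a := hx.1
        have e2 : inner ℝ n p = a := hp.1
        simp [real_inner_comm, e1, e2]
      · have e1 : inner ℝ m x = b := hx.2
        have e2 : inner ℝ m p = b := hp.2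
        simp [real_inner_comm, e1, e2]
    have h0 : inner ℝ (x - p) u = 0 := this hu
    exact h0
  have hiso : Isometry (fun y : Wᗮ => (y : E d) + p) :=
    (isometry_add_right p).comp isometry_subtype_coe
  refine measure_mono_null hsub ?_
  have hlt : finrank ℝ Wᗮ < d - 1 := by omega
  have h0 : (Measure.hausdorffMeasure ((d - 1 : ℕ) : ℝ) : Measure Wᗮ) = 0 :=
    Real.hausdorffMeasure_of_finrank_lt (by exact_mod_cast hlt)
  rw [← Set.image_univ, hiso.euclideanHausdorffMeasure_image,
    Measure.euclideanHausdorffMeasure_def, Measure.smul_apply, h0]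
  simp

/-- Fubini decomposition of Lebesgue measure along the unit direction `n`. -/
lemma measurePreserving_perp_add_smul (hn : ‖n‖ = 1) :
    MeasurePreserving (fun z : (ℝ ∙ n)ᗮ × ℝ => (z.1 : E d) + z.2 • n) volume volume := by
  have h1 := ((ℝ ∙ n).measurePreserving_measurableEquivProd (0 : E d)).symm
  rw [InnerProductSpace.euclideanHausdorffMeasure_eq_volume] at h1
  have h2 := (LinearIsometryEquiv.toSpanUnitSingleton (𝕜 := ℝ) n hn).measurePreserving.prod
    (MeasurePreserving.id (volume : Measure (ℝ ∙ n)ᗮ))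
  have h3 := (h1.comp h2).comp
    (Measure.measurePreserving_swap (μ := (volume : Measure (ℝ ∙ n)ᗮ)) (ν := (volume : Measure ℝ)))
  have e : (fun z : (ℝ ∙ n)ᗮ × ℝ => (z.1 : E d) + z.2 • n)
      = (⇑((ℝ ∙ n).measurableEquivProd (0 : E d)).symm ∘
        Prod.map (LinearIsometryEquiv.toSpanUnitSingleton (𝕜 := ℝ) n hn) id) ∘ Prod.swap := by
    funext z
    simp [add_comm]
  rw [e]
  exact h3

lemma measurableEmbedding_perp_add_smul (hn : ‖n‖ = 1) :
    MeasurableEmbedding (fun z : (ℝ ∙ n)ᗮ × ℝ => (z.1 : E d) + z.2 • n) := by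
  have hc : Continuous (fun z : (ℝ ∙ n)ᗮ × ℝ => (z.1 : E d) + z.2 • n) := by fun_prop
  refine hc.measurableEmbedding fun z w h => ?_
  have h' : (z.1 : E d) + z.2 • n = (w.1 : E d) + w.2 • n := h
  have h2 : z.2 = w.2 := by
    rw [← inner_hyperMap hn z.1 z.2, h', inner_hyperMap hn]
  refine Prod.ext (Subtype.ext ?_) h2
  rw [h2] at h'
  exact add_right_cancel h'

/-- Integration in the coordinates `x = y + (a - δ s) n` with `y ⟂ n`. -/
lemma integral_eq_integral_perp_scaled (hn : ‖n‖ = 1) (a : ℝ) {δ : ℝ} (hδ : 0 < δ) (f : E d → ℝ) :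
    ∫ x, f x = δ * ∫ z : (ℝ ∙ n)ᗮ × ℝ, f ((z.1 : E d) + (a - δ * z.2) • n) := by
  have hmp : MeasurePreserving (fun t : ℝ => a - δ * t)
      volume (ENNReal.ofReal δ⁻¹ • volume) := by
    refine ⟨by fun_prop, ?_⟩
    have e : (fun t : ℝ => a - δ * t) = (fun s => a + s) ∘ fun t : ℝ => (-δ) * t := by
      funext t; simp [sub_eq_add_neg]
    rw [e, ← Measure.map_map (by fun_prop) (by fun_prop),
      Real.map_volume_mul_left (by linarith), Measure.map_smul, map_add_left_eq_self]
    congr 2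
    rw [inv_neg, abs_neg, abs_of_pos (by positivity)]
  have hemb : MeasurableEmbedding (fun t : ℝ => a - δ * t) := by
    have hc : Continuous (fun t : ℝ => a - δ * t) := by fun_prop
    refine hc.measurableEmbedding fun s t h => ?_
    have h' : a - δ * s = a - δ * t := h
    have : δ * s = δ * t := by linarith
    exact mul_left_cancel₀ hδ.ne' this
  have h2 := (MeasurePreserving.id (volume : Measure (ℝ ∙ n)ᗮ)).prod hmp
  have hemb2 : MeasurableEmbedding
      (Prod.map id (fun t : ℝ => a - δ * t) : (ℝ ∙ n)ᗮ × ℝ → (ℝ ∙ n)ᗮ × ℝ) :=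
    MeasurableEmbedding.id.prodMap hemb
  have h3 := h2.integral_comp hemb2 fun z => f ((z.1 : E d) + z.2 • n)
  rw [← (measurePreserving_perp_add_smul hn).integral_comp
    (measurableEmbedding_perp_add_smul hn) f]
  rw [Measure.prod_smul_right, integral_smul_measure] at h3
  simp only [Prod.map_fst, Prod.map_snd, id] at h3
  rw [Measure.volume_eq_prod, h3, ENNReal.toReal_ofReal (by positivity), smul_eq_mul,
    mul_inv_cancel_left₀ hδ.ne']

end Hyperplanes

/-! ### Convex polytopes -/

namespace Polytope

variable {d : ℕ} (K : Polytope d)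

lemma isClosed_carrier : IsClosed K.carrier := by
  have : K.carrier = ⋂ n ∈ K.normals, {x | inner ℝ n x ≤ K.offset n} := by
    ext x; simp [carrier]
  rw [this]
  exact isClosed_biInter fun n _ => isClosed_le (by fun_prop) continuous_const

lemma isCompact_carrier : IsCompact K.carrier :=
  Metric.isCompact_of_isClosed_isBounded K.isClosed_carrier K.bounded

lemma measurableSet_carrier : MeasurableSet K.carrier := K.isClosed_carrier.measurableSet

lemma convex_carrier : Convex ℝ K.carrier := by
  have : K.carrier = ⋂ n ∈ K.normals, {x | inner ℝ n x ≤ K.offset n} := by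
    ext x; simp [carrier]
  rw [this]
  exact convex_iInter₂ fun n _ => convex_halfSpace_le (innerSL ℝ n).isLinear _

lemma interior_carrier : interior K.carrier = {x | ∀ n ∈ K.normals, inner ℝ n x < K.offset n} := by
  apply subset_antisymm
  · intro x hx n hn
    have ht : Tendsto (fun t : ℝ => x + t • n) (𝓝[>] 0) (𝓝 x) := by
      have : Continuous fun t : ℝ => x + t • n := by fun_prop
      have h := this.tendsto 0
      simp only [zero_smul, add_zero] at h
      exact h.mono_left nhdsWithin_le_nhds
    obtain ⟨t, ht1, ht2⟩ :=
      ((ht.eventually (mem_interior_iff_mem_nhds.1 hx)).and self_mem_nhdsWithin).exists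
    have h1 := ht1 n hn
    rw [inner_add_right, inner_smul_right, inner_self_of_norm_one (K.norm_eq_one n hn)] at h1
    have h2 : (0 : ℝ) < t := ht2
    linarith
  · refine interior_maximal (fun x hx n hn => (hx n hn).le) ?_
    have : {x | ∀ n ∈ K.normals, inner ℝ n x < K.offset n}
        = ⋂ n ∈ K.normals, {x | inner ℝ n x < K.offset n} := by ext x; simp
    rw [this]
    exact isOpen_biInter_finset fun n _ => isOpen_lt (by fun_prop) continuous_const

lemma volume_frontier : volume (frontier K.carrier) = 0 :=
  K.convex_carrier.addHaar_frontier volume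

lemma ae_mem_interior : ∀ᵐ x ∂(volume.restrict K.carrier), x ∈ interior K.carrier := by
  rw [ae_restrict_iff' K.measurableSet_carrier]
  have h : ∀ᵐ x, x ∉ frontier K.carrier := measure_eq_zero_iff_ae_notMem.1 K.volume_frontier
  filter_upwards [h] with x hx hxK
  by_contra hi
  exact hx ⟨subset_closure hxK, hi⟩

lemma restrict_interior : volume.restrict (interior K.carrier) = volume.restrict K.carrier := by
  refine Measure.restrict_congr_set ?_
  refine (show interior K.carrier ≤ K.carrier from interior_subset).eventuallyLE.antisymm ?_
  have h : ∀ᵐ x, x ∉ frontier K.carrier := measure_eq_zero_iff_ae_notMem.1 K.volume_frontier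
  filter_upwards [h] with x hx hxK
  by_contra hi
  exact hx ⟨subset_closure hxK, hi⟩

lemma nonempty_interior_carrier : (interior K.carrier).Nonempty := K.nonempty_interior

lemma isClosed_facet (n : E d) : IsClosed (K.facet n) :=
  K.isClosed_carrier.inter (isClosed_hyper n (K.offset n))

lemma facet_subset_carrier (n : E d) : K.facet n ⊆ K.carrier := fun _ hx => hx.1

lemma facet_subset_hyper (n : E d) : K.facet n ⊆ hyper n (K.offset n) := fun _ hx => hx.2

lemma isCompact_facet (n : E d) : IsCompact (K.facet n) :=
  K.isCompact_carrier.of_isClosed_subset (K.isClosed_facet n) (K.facet_subset_carrier n)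

/-- Opposite facets lie in different hyperplanes. -/
lemma neg_offset_lt {n : E d} (hn : n ∈ K.normals) (hn' : -n ∈ K.normals) :
    -K.offset (-n) < K.offset n := by
  obtain ⟨x, hx⟩ := K.nonempty_interior_carrier
  rw [interior_carrier] at hx
  have h1 := hx n hn
  have h2 := hx (-n) hn'
  rw [inner_neg_left] at h2
  linarith

/-- Continuous functions on the carrier are integrable over subsets of facets. -/
lemma integrableOn_facet {n : E d} (hn : n ∈ K.normals) {s : Set (E d)} (hs : IsClosed s)
    (hsub : s ⊆ K.facet n) {f : E d → ℝ} (hf : ContinuousOn f s) :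
    IntegrableOn f s (surf d) := by
  have := isFiniteMeasureOnCompacts_surf_hyper (K.norm_eq_one n hn) (K.offset n)
  have hc : IsCompact s := (K.isCompact_facet n).of_isClosed_subset hs hsub
  have h := hf.integrableOn_compact' (μ := (surf d).restrict (hyper n (K.offset n))) hc
    hs.measurableSet
  rwa [IntegrableOn, Measure.restrict_restrict hs.measurableSet, Set.inter_eq_left.2
    (hsub.trans (K.facet_subset_hyper n))] at h

lemma surf_facet_lt_top {n : E d} (hn : n ∈ K.normals) : surf d (K.facet n) < ⊤ := by
  have := isFiniteMeasureOnCompacts_surf_hyper (K.norm_eq_one n hn) (K.offset n)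
  have h := (K.isCompact_facet n).measure_lt_top (μ := (surf d).restrict (hyper n (K.offset n)))
  rwa [Measure.restrict_apply (K.isClosed_facet n).measurableSet, Set.inter_eq_left.2
    (K.facet_subset_hyper n)] at h

end Polytope

/-! ### A smooth cut-off in the interior of a polytope -/

/-- A smooth monotone function equal to `0` on `(-∞, 1]` and to `1` on `[2, ∞)`. -/
noncomputable def ramp (s : ℝ) : ℝ := Real.smoothTransition (s - 1)

lemma contDiff_ramp : ContDiff ℝ ∞ ramp :=
  Real.smoothTransition.contDiff.comp (contDiff_id.sub contDiff_const)

lemma ramp_of_le {s : ℝ} (hs : s ≤ 1) : ramp s = 0 :=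
  Real.smoothTransition.zero_of_nonpos (by linarith)

lemma ramp_of_ge {s : ℝ} (hs : 2 ≤ s) : ramp s = 1 :=
  Real.smoothTransition.one_of_one_le (by linarith)

lemma abs_ramp_le (s : ℝ) : |ramp s| ≤ 1 := by
  rw [ramp, abs_of_nonneg (Real.smoothTransition.nonneg _)]
  exact Real.smoothTransition.le_one _

lemma hasDerivAt_ramp (s : ℝ) : HasDerivAt ramp (deriv ramp s) s :=
  (contDiff_ramp.differentiable (by simp) s).hasDerivAt

lemma continuous_deriv_ramp : Continuous (deriv ramp) := contDiff_ramp.continuous_deriv (by simp)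

lemma deriv_ramp_of_le {s : ℝ} (hs : s ≤ 1) : deriv ramp s = 0 := by
  have h : IsClosed {s | deriv ramp s = 0} := isClosed_eq continuous_deriv_ramp continuous_const
  have hsub : Set.Iio (1 : ℝ) ⊆ {s | deriv ramp s = 0} := by
    intro t ht
    have : ramp =ᶠ[𝓝 t] fun _ => 0 := by
      filter_upwards [Iio_mem_nhds ht] with u hu using ramp_of_le (le_of_lt hu)
    simpa using this.deriv_eq
  have := h.closure_subset_iff.2 hsub
  rw [closure_Iio] at this
  exact this hs

lemma deriv_ramp_of_ge {s : ℝ} (hs : 2 ≤ s) : deriv ramp s = 0 := by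
  have h : IsClosed {s | deriv ramp s = 0} := isClosed_eq continuous_deriv_ramp continuous_const
  have hsub : Set.Ioi (2 : ℝ) ⊆ {s | deriv ramp s = 0} := by
    intro t ht
    have : ramp =ᶠ[𝓝 t] fun _ => 1 := by
      filter_upwards [Ioi_mem_nhds ht] with u hu using ramp_of_ge (le_of_lt hu)
    simpa using this.deriv_eq
  have := h.closure_subset_iff.2 hsub
  rw [closure_Ioi] at this
  exact this hs

lemma hasCompactSupport_deriv_ramp : HasCompactSupport (deriv ramp) := by
  refine HasCompactSupport.of_support_subset_isCompact (isCompact_Icc (a := (1 : ℝ)) (b := 2)) ?_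
  intro s hs
  refine ⟨?_, ?_⟩ <;> by_contra h
  · exact hs (deriv_ramp_of_le (not_le.1 h).le)
  · exact hs (deriv_ramp_of_ge (not_le.1 h).le)

lemma integrable_deriv_ramp : Integrable (deriv ramp) :=
  continuous_deriv_ramp.integrable_of_hasCompactSupport hasCompactSupport_deriv_ramp

lemma integral_deriv_ramp : ∫ s, deriv ramp s = 1 := by
  have h := integral_of_hasDerivAt_of_tendsto (f := ramp) (f' := deriv ramp) (m := 0) (n := 1)
    hasDerivAt_ramp integrable_deriv_ramp
    (tendsto_const_nhds.congr' (by
      filter_upwards [eventually_le_atBot 1] with s hs using (ramp_of_le hs).symm))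
    (tendsto_const_nhds.congr' (by
      filter_upwards [eventually_ge_atTop 2] with s hs using (ramp_of_ge hs).symm))
  simpa using h

namespace Polytope

variable {d : ℕ} (K : Polytope d)

/-- A smooth function with values in `[0, 1]` that vanishes at distance less than `δ` from the
facet hyperplanes and is `1` at distance more than `2δ` from them, inside the polytope. -/
noncomputable def cutoff (δ : ℝ) (x : E d) : ℝ :=
  ∏ m ∈ K.normals, ramp ((K.offset m - inner ℝ m x) / δ)

open Classical in
lemma measurable_indicator_carrier {f : E d → ℝ} (hf : ContinuousOn f K.carrier) :
    Measurable (K.carrier.indicator f) := by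
  rw [← Set.piecewise_eq_indicator]
  exact hf.measurable_piecewise continuousOn_const K.measurableSet_carrier

lemma abs_prod_ramp_le (s : Finset (E d)) (δ : ℝ) (x : E d) :
    |∏ m ∈ s, ramp ((K.offset m - inner ℝ m x) / δ)| ≤ 1 := by
  rw [Finset.abs_prod]
  exact Finset.prod_le_one (fun _ _ => abs_nonneg _) fun _ _ => abs_ramp_le _

lemma tendsto_ramp_one {a : ℝ} (ha : 0 < a) {u : ℝ → ℝ} (hu : Tendsto u (𝓝[>] 0) (𝓝 a)) :
    ∀ᶠ δ in 𝓝[>] (0 : ℝ), ramp (u δ / δ) = 1 := by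
  have h := hu.pos_mul_atTop ha tendsto_inv_nhdsGT_zero
  filter_upwards [h.eventually_ge_atTop 2] with δ hδ
  exact ramp_of_ge (by rwa [div_eq_mul_inv])

lemma tendsto_ramp_zero {a : ℝ} (ha : a < 0) {u : ℝ → ℝ} (hu : Tendsto u (𝓝[>] 0) (𝓝 a)) :
    ∀ᶠ δ in 𝓝[>] (0 : ℝ), ramp (u δ / δ) = 0 := by
  have h := hu.neg_mul_atTop ha tendsto_inv_nhdsGT_zero
  filter_upwards [h.eventually_le_atBot 1] with δ hδ
  exact ramp_of_le (by rwa [div_eq_mul_inv])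

/-- Almost every point of the hyperplane of a facet lies on no other facet hyperplane. -/
lemma ae_hyper_ne {n : E d} (hn : n ∈ K.normals) :
    ∀ᵐ y : (ℝ ∙ n)ᗮ, ∀ m ∈ K.normals, m ≠ n →
      inner ℝ m ((y : E d) + K.offset n • n) ≠ K.offset m := by
  have hn1 := K.norm_eq_one n hn
  refine (ae_ball_iff K.normals.countable_toSet).2 ?_
  intro m hm
  by_cases h1 : m = n
  · exact Eventually.of_forall fun y h => absurd h1 h
  by_cases h2 : m = -n
  · refine Eventually.of_forall fun y _ h => ?_
    subst h2
    rw [inner_neg_left, inner_hyperMap hn1] at h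
    have := K.neg_offset_lt hn hm
    linarith
  have h0 := surf_hyper_inter_hyper hn1 (K.norm_eq_one m hm) h1 h2 (K.offset n) (K.offset m)
  rw [Set.inter_comm, ← Measure.restrict_apply (isClosed_hyper _ _).measurableSet,
    ← map_hyperMap hn1, (measurableEmbedding_hyperMap n _).map_apply] at h0
  filter_upwards [measure_eq_zero_iff_ae_notMem.1 h0] with y hy _ using hy

open Classical in
/-- The mass of `∇ cutoff` in the direction of a normal concentrates on the facet. -/
lemma tendsto_integral_layer {n : E d} (hn : n ∈ K.normals) {f : E d → ℝ}
    (hf : ContinuousOn f K.carrier) :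
    Tendsto (fun δ : ℝ => ∫ x in K.carrier, f x *
        (δ⁻¹ * deriv ramp ((K.offset n - inner ℝ n x) / δ) *
          ∏ m ∈ K.normals.erase n, ramp ((K.offset m - inner ℝ m x) / δ)))
      (𝓝[>] 0) (𝓝 (∫ x in K.facet n, f x ∂(surf d))) := by
  have hn1 := K.norm_eq_one n hn
  set a := K.offset n with ha
  set F := K.carrier.indicator f with hF
  have hFm : Measurable F := K.measurable_indicator_carrier hf
  obtain ⟨B, hB⟩ : ∃ B, ∀ x, |F x| ≤ B := by
    obtain ⟨B, hB⟩ := K.isCompact_carrier.exists_bound_of_continuousOn hf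
    refine ⟨max B 0, fun x => ?_⟩
    by_cases hx : x ∈ K.carrier
    · rw [hF, Set.indicator_of_mem hx]; exact le_max_of_le_left (hB x hx)
    · rw [hF, Set.indicator_of_notMem hx, abs_zero]; exact le_max_right _ _
  have hB0 : 0 ≤ B := (abs_nonneg _).trans (hB 0)
  obtain ⟨R, hR⟩ := K.isCompact_carrier.isBounded.exists_norm_le
  -- the point of parameters `(y, s)` at scale `δ`
  set X : ℝ → (ℝ ∙ n)ᗮ × ℝ → E d := fun δ z => (z.1 : E d) + (a - δ * z.2) • n with hX
  have hXn : ∀ δ z, inner ℝ n (X δ z) = a - δ * z.2 := fun δ z => inner_hyperMap hn1 _ _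
  have hXc : ∀ δ, Continuous (X δ) := fun δ => by fun_prop
  set Y : (ℝ ∙ n)ᗮ → E d := fun y => (y : E d) + a • n with hY
  have hXlim : ∀ z : (ℝ ∙ n)ᗮ × ℝ, Tendsto (fun δ => X δ z) (𝓝[>] 0) (𝓝 (Y z.1)) := by
    intro z
    have hc : Continuous fun δ => X δ z := by fun_prop
    have h := hc.tendsto 0
    simp only [hX, zero_mul, sub_zero] at h
    exact h.mono_left nhdsWithin_le_nhds
  set P : ℝ → E d → ℝ := fun δ x =>
    ∏ m ∈ K.normals.erase n, ramp ((K.offset m - inner ℝ m x) / δ) with hP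
  have hPc : ∀ δ, Continuous (P δ) := fun δ => by
    refine continuous_finsetProd _ fun m _ => contDiff_ramp.continuous.comp ?_
    fun_prop
  -- pass to the scaled coordinates
  have hrew : ∀ δ : ℝ, 0 < δ → ∫ x in K.carrier, f x *
        (δ⁻¹ * deriv ramp ((a - inner ℝ n x) / δ) * P δ x)
      = ∫ z : (ℝ ∙ n)ᗮ × ℝ, F (X δ z) * (deriv ramp z.2 * P δ (X δ z)) := by
    intro δ hδ
    rw [← integral_indicator K.measurableSet_carrier]
    have e : K.carrier.indicator (fun x => f x *
        (δ⁻¹ * deriv ramp ((a - inner ℝ n x) / δ) * P δ x))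
        = fun x => F x * (δ⁻¹ * deriv ramp ((a - inner ℝ n x) / δ) * P δ x) := by
      funext x
      rw [hF, Set.indicator_mul_left]
    rw [e, integral_eq_integral_perp_scaled hn1 a hδ, ← integral_const_mul]
    refine integral_congr_ae (Eventually.of_forall fun z => ?_)
    show δ * (F (X δ z) * (δ⁻¹ * deriv ramp ((a - inner ℝ n (X δ z)) / δ) * P δ (X δ z)))
      = F (X δ z) * (deriv ramp z.2 * P δ (X δ z))
    rw [hXn, sub_sub_cancel, mul_div_cancel_left₀ _ hδ.ne']
    field_simp
  -- the limit integral
  have hlim : ∫ x in K.facet n, f x ∂(surf d)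
      = ∫ z : (ℝ ∙ n)ᗮ × ℝ, F (Y z.1) * deriv ramp z.2 := by
    have h1 : ∫ z : (ℝ ∙ n)ᗮ × ℝ, F (Y z.1) * deriv ramp z.2
        = (∫ y, F (Y y)) * ∫ s, deriv ramp s := by
      rw [Measure.volume_eq_prod]
      exact integral_prod_mul (fun y => F (Y y)) (deriv ramp)
    rw [h1, integral_deriv_ramp, mul_one, ← setIntegral_hyper hn1 a F, hF,
      setIntegral_indicator K.measurableSet_carrier]
    congr 2
    ext x
    exact and_comm
  rw [hlim]
  refine (tendsto_congr' (f₂ := fun δ => ∫ z : (ℝ ∙ n)ᗮ × ℝ,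
    F (X δ z) * (deriv ramp z.2 * P δ (X δ z))) ?_).2 ?_
  · filter_upwards [self_mem_nhdsWithin] with δ hδ using hrew δ hδ
  -- the integrand is supported in a bounded set of `y`, and in `s ∈ [1, 2]`
  refine tendsto_integral_filter_of_dominated_convergence
    (fun z => (Metric.closedBall (0 : (ℝ ∙ n)ᗮ) R).indicator (fun _ => B) z.1 *
      |deriv ramp z.2|) ?_ ?_ ?_ ?_
  · refine Eventually.of_forall fun δ => Measurable.aestronglyMeasurable ?_
    exact (hFm.comp (hXc δ).measurable).mul
      ((continuous_deriv_ramp.measurable.comp measurable_snd).mul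
        ((hPc δ).comp (hXc δ)).measurable)
  · refine Eventually.of_forall fun δ => Eventually.of_forall fun z => ?_
    rw [Real.norm_eq_abs, abs_mul, abs_mul]
    by_cases hz : X δ z ∈ K.carrier
    · have hzR : z.1 ∈ Metric.closedBall (0 : (ℝ ∙ n)ᗮ) R := by
        rw [mem_closedBall_zero_iff]
        refine le_trans ?_ (hR _ hz)
        have h2 : ‖X δ z‖ * ‖X δ z‖ = ‖(z.1 : E d)‖ * ‖(z.1 : E d)‖
            + ‖(a - δ * z.2) • n‖ * ‖(a - δ * z.2) • n‖ := by
          refine norm_add_sq_eq_norm_sq_add_norm_sq_real ?_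
          rw [inner_smul_right, real_inner_comm, inner_perp, mul_zero]
        have h3 : ‖z.1‖ = ‖(z.1 : E d)‖ := rfl
        rw [h3]
        nlinarith [norm_nonneg (X δ z), norm_nonneg (z.1 : E d),
          mul_self_nonneg ‖(a - δ * z.2) • n‖]
      rw [Set.indicator_of_mem hzR]
      have := K.abs_prod_ramp_le (K.normals.erase n) δ (X δ z)
      calc |F (X δ z)| * (|deriv ramp z.2| * |P δ (X δ z)|)
          ≤ B * (|deriv ramp z.2| * 1) := by gcongr; exact hB _
        _ = B * |deriv ramp z.2| := by rw [mul_one]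
    · rw [hF, Set.indicator_of_notMem hz, abs_zero, zero_mul]
      exact mul_nonneg (Set.indicator_nonneg (fun _ _ => hB0) _) (abs_nonneg _)
  · rw [Measure.volume_eq_prod]
    refine Integrable.mul_prod (f := (Metric.closedBall (0 : (ℝ ∙ n)ᗮ) R).indicator fun _ => B) ?_
      integrable_deriv_ramp.abs
    rw [integrable_indicator_iff Metric.isClosed_closedBall.measurableSet]
    exact integrableOn_const (isCompact_closedBall _ _).measure_lt_top.ne
  · have hae : ∀ᵐ z : (ℝ ∙ n)ᗮ × ℝ, ∀ m ∈ K.normals, m ≠ n →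
        inner ℝ m (Y z.1) ≠ K.offset m := by
      rw [Measure.volume_eq_prod]
      exact Measure.quasiMeasurePreserving_fst.ae (K.ae_hyper_ne hn)
    filter_upwards [hae] with z hz
    rcases le_or_gt z.2 1 with hs | hs
    · simp [deriv_ramp_of_le hs]
    have hm : ∀ m, Tendsto (fun δ => K.offset m - inner ℝ m (X δ z)) (𝓝[>] 0)
        (𝓝 (K.offset m - inner ℝ m (Y z.1))) := fun m =>
      tendsto_const_nhds.sub (((innerSL ℝ m).continuous.tendsto _).comp (hXlim z))
    -- either `Y y` is a relative interior point of the facet and the other ramps are eventually `1`,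
    -- or it violates another inequality strictly and that ramp is eventually `0`
    by_cases hY1 : ∀ m ∈ K.normals, m ≠ n → inner ℝ m (Y z.1) < K.offset m
    · have hYK : Y z.1 ∈ K.carrier := by
        intro m hmK
        by_cases hmn : m = n
        · subst hmn; exact (inner_hyperMap hn1 _ _).le
        · exact (hY1 m hmK hmn).le
      have hP1 : ∀ᶠ δ in 𝓝[>] (0 : ℝ), P δ (X δ z) = 1 := by
        have : ∀ᶠ δ in 𝓝[>] (0 : ℝ), ∀ m ∈ K.normals.erase n,
            ramp ((K.offset m - inner ℝ m (X δ z)) / δ) = 1 := by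
          rw [eventually_all_finset]
          intro m hmK
          rw [Finset.mem_erase] at hmK
          exact tendsto_ramp_one (by linarith [hY1 m hmK.2 hmK.1]) (hm m)
        filter_upwards [this] with δ hδ using Finset.prod_eq_one hδ
      have hXK : ∀ᶠ δ in 𝓝[>] (0 : ℝ), X δ z ∈ K.carrier := by
        have h1 : ∀ᶠ δ in 𝓝[>] (0 : ℝ), ∀ m ∈ K.normals.erase n,
            0 < K.offset m - inner ℝ m (X δ z) := by
          rw [eventually_all_finset]
          intro m hmK
          rw [Finset.mem_erase] at hmK
          exact (hm m).eventually_const_lt (by linarith [hY1 m hmK.2 hmK.1])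
        filter_upwards [h1, self_mem_nhdsWithin] with δ hδ hδ0 m hmK
        by_cases hmn : m = n
        · subst hmn
          rw [hXn]
          have : 0 < δ * z.2 := mul_pos hδ0 (by linarith)
          linarith
        · linarith [hδ m (Finset.mem_erase.2 ⟨hmn, hmK⟩)]
      have hFlim : Tendsto (fun δ => F (X δ z)) (𝓝[>] 0) (𝓝 (F (Y z.1))) := by
        rw [hF, Set.indicator_of_mem hYK]
        refine ((hf _ hYK).tendsto.comp (tendsto_nhdsWithin_iff.2 ⟨hXlim z, hXK⟩)).congr' ?_
        filter_upwards [hXK] with δ hδ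
        rw [Set.indicator_of_mem hδ]; rfl
      refine (hFlim.mul_const (deriv ramp z.2)).congr' ?_
      filter_upwards [hP1] with δ hδ
      rw [hδ, mul_one]
    · push Not at hY1
      obtain ⟨m, hmK, hmn, hle⟩ := hY1
      have hlt : K.offset m < inner ℝ m (Y z.1) := lt_of_le_of_ne hle (hz m hmK hmn).symm
      have hYK : Y z.1 ∉ K.carrier := fun h => absurd (h m hmK) (not_le.2 hlt)
      rw [hF, Set.indicator_of_notMem hYK, zero_mul]
      refine tendsto_const_nhds.congr' ?_
      filter_upwards [tendsto_ramp_zero (by linarith) (hm m)] with δ hδ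
      have : P δ (X δ z) = 0 := Finset.prod_eq_zero (Finset.mem_erase.2 ⟨hmn, hmK⟩) hδ
      rw [this, mul_zero, mul_zero]

end Polytope

/-! ### The divergence theorem on a polytope -/

namespace Polytope

variable {d : ℕ} (K : Polytope d)

lemma contDiff_cutoff (δ : ℝ) : ContDiff ℝ ∞ (K.cutoff δ) := by
  unfold cutoff
  refine contDiff_prod fun m _ => contDiff_ramp.comp ?_
  exact (contDiff_const.sub (contDiff_const.inner ℝ contDiff_id)).div_const δ

lemma abs_cutoff_le (δ : ℝ) (x : E d) : |K.cutoff δ x| ≤ 1 := K.abs_prod_ramp_le _ _ _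

/-- The part of the polytope at distance at least `δ` from the facet hyperplanes. -/
def inset (δ : ℝ) : Set (E d) := {x | ∀ m ∈ K.normals, inner ℝ m x + δ ≤ K.offset m}

lemma isClosed_inset (δ : ℝ) : IsClosed (K.inset δ) := by
  have : K.inset δ = ⋂ n ∈ K.normals, {x | inner ℝ n x + δ ≤ K.offset n} := by
    ext x; simp [inset]
  rw [this]
  exact isClosed_biInter fun n _ => isClosed_le (by fun_prop) continuous_const

lemma inset_subset_interior {δ : ℝ} (hδ : 0 < δ) : K.inset δ ⊆ interior K.carrier := by
  rw [interior_carrier]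
  intro x hx m hm
  linarith [hx m hm]

lemma cutoff_eq_zero {δ : ℝ} (hδ : 0 < δ) {x : E d} (hx : x ∉ K.inset δ) : K.cutoff δ x = 0 := by
  simp only [inset, Set.mem_ofPred_eq, not_forall, not_le] at hx
  obtain ⟨m, hm, hlt⟩ := hx
  refine Finset.prod_eq_zero hm (ramp_of_le ?_)
  rw [div_le_one hδ]
  linarith

lemma tendsto_cutoff {x : E d} (hx : x ∈ interior K.carrier) :
    Tendsto (fun δ => K.cutoff δ x) (𝓝[>] 0) (𝓝 1) := by
  rw [interior_carrier] at hx
  have : ∀ᶠ δ in 𝓝[>] (0 : ℝ), ∀ m ∈ K.normals, ramp ((K.offset m - inner ℝ m x) / δ) = 1 := by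
    rw [eventually_all_finset]
    intro m hm
    exact tendsto_ramp_one (by linarith [hx m hm] : 0 < K.offset m - inner ℝ m x)
      tendsto_const_nhds
  refine tendsto_const_nhds.congr' ?_
  filter_upwards [this] with δ hδ using (Finset.prod_eq_one hδ).symm

open Classical in
lemma fderiv_cutoff (δ : ℝ) (x v : E d) :
    fderiv ℝ (K.cutoff δ) x v = -∑ n ∈ K.normals, inner ℝ n v *
      (δ⁻¹ * deriv ramp ((K.offset n - inner ℝ n x) / δ) *
          ∏ m ∈ K.normals.erase n, ramp ((K.offset m - inner ℝ m x) / δ)) := by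
  have h1 : ∀ n ∈ K.normals, HasFDerivAt (fun x => ramp ((K.offset n - inner ℝ n x) / δ))
      ((deriv ramp ((K.offset n - inner ℝ n x) / δ)) • (δ⁻¹ • -(innerSL ℝ n))) x := by
    intro n _
    have h2 : HasFDerivAt (fun x : E d => (K.offset n - inner ℝ n x) / δ)
        (δ⁻¹ • -(innerSL ℝ n)) x := by
      have h3 := (((innerSL ℝ n).hasFDerivAt (x := x)).const_sub (K.offset n)).const_smul δ⁻¹
      refine h3.congr_of_eventuallyEq (Eventually.of_forall fun y => ?_)
      simp [div_eq_inv_mul]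
    exact (hasDerivAt_ramp _).comp_hasFDerivAt x h2
  have h := HasFDerivAt.finsetProd h1
  have h' : HasFDerivAt (K.cutoff δ) _ x := h
  rw [h'.fderiv, sum_apply, ← Finset.sum_neg_distrib]
  refine Finset.sum_congr rfl fun n _ => ?_
  simp
  ring

open Classical in
/-- The divergence theorem on a polytope, in the direction `e_i`, for the product of a continuous
function `f` with bounded weak derivative `g` and a smooth function `φ`. The weak formulation is
tested with `φ` times the cut-off. -/
theorem integral_mul_fderiv_add_eq_sum_facet {Ω : Set (E d)} (hΩ : interior K.carrier ⊆ Ω)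
    {i : Fin d} {f g : E d → ℝ} (hfg : HasWeakPartial Ω i f g) (hf : ContinuousOn f K.carrier)
    (hg : IntegrableOn g K.carrier) {φ : E d → ℝ} (hφ : ContDiff ℝ ∞ φ) :
    (∫ x in K.carrier, f x * fderiv ℝ φ x (EuclideanSpace.single i 1))
        + ∫ x in K.carrier, g x * φ x
      = ∑ n ∈ K.normals, n i * ∫ x in K.facet n, f x * φ x ∂(surf d) := by
  set v : E d := EuclideanSpace.single i 1 with hv
  have hvn : ∀ n : E d, inner ℝ n v = n i := fun n => by
    rw [hv, EuclideanSpace.inner_single_right]; simp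
  set L : E d → ℝ → E d → ℝ := fun n δ x => δ⁻¹ * deriv ramp ((K.offset n - inner ℝ n x) / δ) *
          ∏ m ∈ K.normals.erase n, ramp ((K.offset m - inner ℝ m x) / δ) with hL
  have hLc : ∀ n δ, Continuous (L n δ) := fun n δ => by
    refine Continuous.mul (continuous_const.mul (continuous_deriv_ramp.comp (by fun_prop))) ?_
    exact continuous_finsetProd _ fun m _ => contDiff_ramp.continuous.comp (by fun_prop)
  have hφc := hφ.continuous
  have hdφ : Continuous fun x => fderiv ℝ φ x v :=
    (hφ.continuous_fderiv (by simp)).clm_apply continuous_const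
  have hint : ∀ {u : E d → ℝ}, ContinuousOn u K.carrier → IntegrableOn u K.carrier := fun hu =>
    hu.integrableOn_compact K.isCompact_carrier
  have hgφ : ∀ {u : E d → ℝ}, Continuous u → IntegrableOn (fun x => g x * u x) K.carrier :=
    fun hu => hg.mul_continuousOn hu.continuousOn K.isCompact_carrier
  have key : ∀ δ : ℝ, 0 < δ →
      (∫ x in K.carrier, f x * (K.cutoff δ x * fderiv ℝ φ x v))
        - ∑ n ∈ K.normals, n i * ∫ x in K.carrier, (f x * φ x) * L n δ x
      = - ∫ x in K.carrier, g x * (φ x * K.cutoff δ x) := by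
    intro δ hδ
    have hψ : ContDiff ℝ ∞ fun x => φ x * K.cutoff δ x := hφ.mul (K.contDiff_cutoff δ)
    have hts : tsupport (fun x => φ x * K.cutoff δ x) ⊆ K.inset δ := by
      refine closure_minimal (fun x hx => ?_) (K.isClosed_inset δ)
      by_contra h
      exact hx (by simp [K.cutoff_eq_zero hδ h])
    have hcs : HasCompactSupport fun x => φ x * K.cutoff δ x :=
      K.isCompact_carrier.of_isClosed_subset (isClosed_tsupport _)
        (hts.trans ((K.inset_subset_interior hδ).trans interior_subset))
    have hw := hfg _ hψ hcs (hts.trans ((K.inset_subset_interior hδ).trans hΩ))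
    have hz : ∀ x ∉ interior K.carrier, fderiv ℝ (fun x => φ x * K.cutoff δ x) x = 0 := by
      intro x hx
      by_contra h
      exact hx (K.inset_subset_interior hδ
        (hts (support_fderiv_subset ℝ (Function.mem_support.2 h))))
    have e1 : ∫ x in Ω, f x * fderiv ℝ (fun x => φ x * K.cutoff δ x) x v
        = ∫ x in K.carrier, f x * fderiv ℝ (fun x => φ x * K.cutoff δ x) x v := by
      rw [← K.restrict_interior, setIntegral_eq_integral_of_forall_compl_eq_zero,
        setIntegral_eq_integral_of_forall_compl_eq_zero]
      · intro x hx
        rw [hz x hx, zero_apply, mul_zero]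
      · intro x hx
        rw [hz x fun h => hx (hΩ h), zero_apply, mul_zero]
    have e2 : ∫ x in Ω, g x * (φ x * K.cutoff δ x)
        = ∫ x in K.carrier, g x * (φ x * K.cutoff δ x) := by
      have hz' : ∀ x ∉ interior K.carrier, K.cutoff δ x = 0 := fun x hx =>
        K.cutoff_eq_zero hδ fun h => hx (K.inset_subset_interior hδ h)
      rw [← K.restrict_interior, setIntegral_eq_integral_of_forall_compl_eq_zero,
        setIntegral_eq_integral_of_forall_compl_eq_zero]
      · intro x hx
        rw [hz' x hx, mul_zero, mul_zero]
      · intro x hx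
        rw [hz' x fun h => hx (hΩ h), mul_zero, mul_zero]
    rw [e1, e2] at hw
    rw [← hw]
    have e3 : ∀ x, f x * fderiv ℝ (fun x => φ x * K.cutoff δ x) x v
        = f x * (K.cutoff δ x * fderiv ℝ φ x v)
          - ∑ n ∈ K.normals, n i * ((f x * φ x) * L n δ x) := by
      intro x
      rw [fderiv_fun_mul (hφ.differentiable (by simp) x)
        ((K.contDiff_cutoff δ).differentiable (by simp) x)]
      simp only [add_apply, smul_apply, smul_eq_mul,
        fderiv_cutoff, hvn]
      rw [mul_add, mul_neg, mul_neg, sub_eq_add_neg, add_comm, Finset.mul_sum, Finset.mul_sum]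
      congr 2
      refine Finset.sum_congr rfl fun n _ => ?_
      simp only [hL]
      ring
    simp_rw [e3]
    rw [integral_sub, integral_finsetSum]
    · simp_rw [integral_const_mul]
    · intro n _
      exact (hint ((hf.mul hφc.continuousOn).mul (hLc n δ).continuousOn)).const_mul _
    · exact hint (hf.mul ((K.contDiff_cutoff δ).continuous.mul hdφ).continuousOn)
    · exact integrable_finsetSum _ fun n _ =>
        (hint ((hf.mul hφc.continuousOn).mul (hLc n δ).continuousOn)).const_mul _
  -- dominated convergence in the volume terms
  have lim : ∀ {u : E d → ℝ}, IntegrableOn u K.carrier →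
      Tendsto (fun δ => ∫ x in K.carrier, u x * K.cutoff δ x) (𝓝[>] 0)
        (𝓝 (∫ x in K.carrier, u x)) := by
    intro u hu
    refine tendsto_integral_filter_of_dominated_convergence (fun x => |u x|) ?_ ?_ hu.abs ?_
    · exact Eventually.of_forall fun δ => hu.aestronglyMeasurable.mul
        (K.contDiff_cutoff δ).continuous.aestronglyMeasurable
    · refine Eventually.of_forall fun δ => Eventually.of_forall fun x => ?_
      rw [Real.norm_eq_abs, abs_mul]
      exact mul_le_of_le_one_right (abs_nonneg _) (K.abs_cutoff_le δ x)
    · filter_upwards [K.ae_mem_interior] with x hx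
      simpa using (K.tendsto_cutoff hx).const_mul (u x)
  have l1 := lim (u := fun x => f x * fderiv ℝ φ x v) (hint (hf.mul hdφ.continuousOn))
  have l2 := lim (hgφ hφc)
  have l3 : Tendsto (fun δ => ∑ n ∈ K.normals, n i * ∫ x in K.carrier, (f x * φ x) * L n δ x)
      (𝓝[>] 0) (𝓝 (∑ n ∈ K.normals, n i * ∫ x in K.facet n, f x * φ x ∂(surf d))) :=
    tendsto_finsetSum _ fun n hn =>
      (K.tendsto_integral_layer hn (hf.mul hφc.continuousOn)).const_mul _
  have l4 := ((l1.sub l3).add l2)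
  have l5 : Tendsto (fun _ : ℝ => (0 : ℝ)) (𝓝[>] 0) (𝓝 0) := tendsto_const_nhds
  have heq := tendsto_nhds_unique (l4.congr' (f₂ := fun _ => (0 : ℝ)) (by
    filter_upwards [self_mem_nhdsWithin] with δ hδ
    have := key δ hδ
    have a1 : ∀ x, f x * fderiv ℝ φ x v * K.cutoff δ x
      = f x * (K.cutoff δ x * fderiv ℝ φ x v) := fun x => by ring
    have a2 : ∀ x, g x * φ x * K.cutoff δ x = g x * (φ x * K.cutoff δ x) := fun x => by ring
    simp_rw [a1, a2]
    linarith)) l5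
  linarith

end Polytope

/-! ### The faces of a mesh tile the facets of its cells -/

namespace Polytope

variable {d : ℕ} (K : Polytope d)

/-- The point `x` lies on the facet with normal `n` and on no other facet. -/
def RegularAt (n x : E d) : Prop :=
  x ∈ K.facet n ∧ ∀ m ∈ K.normals, m ≠ n → inner ℝ m x < K.offset m

variable {K}

/-- Near a regular point of a facet the polytope is a half-space. -/
lemma RegularAt.eventually_mem {n x : E d} (h : K.RegularAt n x) :
    ∀ᶠ y in 𝓝 x, inner ℝ n y ≤ inner ℝ n x → y ∈ K.carrier := by
  have h1 : ∀ᶠ y in 𝓝 x, ∀ m ∈ K.normals, m ≠ n → inner ℝ m y < K.offset m := by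
    rw [eventually_all_finset]
    intro m hm
    by_cases hmn : m = n
    · exact Eventually.of_forall fun y h => absurd hmn h
    · have hc : Continuous fun y : E d => inner ℝ m y := by fun_prop
      filter_upwards [(hc.tendsto x).eventually_lt_const (h.2 m hm hmn)] with y hy _ using hy
  filter_upwards [h1] with y hy hle m hm
  by_cases hmn : m = n
  · subst hmn; exact hle.trans h.1.2.le
  · exact (hy m hm hmn).le

lemma tendsto_sub_smul (x n : E d) : Tendsto (fun t : ℝ => x - t • n) (𝓝[>] 0) (𝓝 x) := by
  have hc : Continuous fun t : ℝ => x - t • n := by fun_prop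
  have h := hc.tendsto 0
  simp only [zero_smul, sub_zero] at h
  exact h.mono_left nhdsWithin_le_nhds

lemma inner_sub_smul_lt {n : E d} (hn : ‖n‖ = 1) (x : E d) {t : ℝ} (ht : 0 < t) :
    inner ℝ n (x - t • n) < inner ℝ n x := by
  rw [inner_sub_right, inner_smul_right, inner_self_of_norm_one hn]
  linarith

/-- From a regular point of a facet one enters the interior against the normal. -/
lemma RegularAt.eventually_sub_mem_interior {n x : E d} (h : K.RegularAt n x)
    (hn : n ∈ K.normals) : ∀ᶠ t in 𝓝[>] (0 : ℝ), x - t • n ∈ interior K.carrier := by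
  rw [interior_carrier]
  have h1 : ∀ᶠ t in 𝓝[>] (0 : ℝ), ∀ m ∈ K.normals, m ≠ n →
      inner ℝ m (x - t • n) < K.offset m := by
    rw [eventually_all_finset]
    intro m hm
    by_cases hmn : m = n
    · exact Eventually.of_forall fun y h => absurd hmn h
    · have hc : Continuous fun y : E d => inner ℝ m y := by fun_prop
      filter_upwards [((hc.tendsto x).comp (tendsto_sub_smul x n)).eventually_lt_const
        (h.2 m hm hmn)] with y hy _ using hy
  filter_upwards [h1, self_mem_nhdsWithin] with t ht ht0 m hm
  by_cases hmn : m = n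
  · subst hmn
    exact (inner_sub_smul_lt (K.norm_eq_one m hn) x ht0).trans_le h.1.2.le
  · exact ht m hm hmn

lemma exists_mem_facet {x : E d} (hx : x ∈ K.carrier) (hi : x ∉ interior K.carrier) :
    ∃ m ∈ K.normals, x ∈ K.facet m := by
  rw [interior_carrier] at hi
  simp only [Set.mem_ofPred_eq, not_forall, not_lt] at hi
  obtain ⟨m, hm, hle⟩ := hi
  exact ⟨m, hm, hx, le_antisymm (hx m hm) hle⟩

lemma closure_interior_carrier (K : Polytope d) : closure (interior K.carrier) = K.carrier := by
  rw [K.convex_carrier.closure_interior_eq_closure_of_nonempty_interior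
    K.nonempty_interior_carrier, K.isClosed_carrier.closure_eq]

end Polytope

namespace Mesh

variable {d : ℕ} {Ω : Set (E d)} (M : Mesh d Ω)

/-- The points that lie in two non-parallel facet hyperplanes of cells of the mesh. -/
def skeleton : Set (E d) :=
  ⋃ (e : Fin M.numCells) (e' : Fin M.numCells) (n ∈ (M.cell e).normals)
    (m ∈ ({m | m ∈ (M.cell e').normals ∧ m ≠ n ∧ m ≠ -n} : Set (E d))),
    hyper n ((M.cell e).offset n) ∩ hyper m ((M.cell e').offset m)

lemma surf_skeleton : surf d M.skeleton = 0 := by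
  refine measure_iUnion_null fun e => measure_iUnion_null fun e' => ?_
  refine (measure_biUnion_null_iff (Finset.countable_toSet _)).2 fun n hn => ?_
  refine (measure_biUnion_null_iff
    ((Finset.countable_toSet (M.cell e').normals).mono fun m hm => hm.1)).2 fun m hm => ?_
  exact surf_hyper_inter_hyper ((M.cell e).norm_eq_one n hn) ((M.cell e').norm_eq_one m hm.1)
    hm.2.1 hm.2.2 _ _

variable {M}

lemma eq_or_eq_neg_of_notMem_skeleton {x : E d} (hx : x ∉ M.skeleton) {e e' : Fin M.numCells}
    {n m : E d} (hn : n ∈ (M.cell e).normals) (hm : m ∈ (M.cell e').normals)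
    (hxn : x ∈ (M.cell e).facet n) (hxm : x ∈ (M.cell e').facet m) : m = n ∨ m = -n := by
  by_contra h
  push Not at h
  refine hx ?_
  simp only [skeleton, Set.mem_iUnion]
  exact ⟨e, e', n, hn, m, ⟨hm, h⟩, hxn.2, hxm.2⟩

lemma regularAt_of_notMem_skeleton {x : E d} (hx : x ∉ M.skeleton) {e : Fin M.numCells}
    {n : E d} (hn : n ∈ (M.cell e).normals) (hxn : x ∈ (M.cell e).facet n) :
    (M.cell e).RegularAt n x := by
  refine ⟨hxn, fun m hm hmn => lt_of_le_of_ne (hxn.1 m hm) fun heq => ?_⟩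
  rcases eq_or_eq_neg_of_notMem_skeleton hx hn hm hxn ⟨hxn.1, heq⟩ with h | h
  · exact hmn h
  · subst h
    have h1 := (M.cell e).neg_offset_lt hn hm
    have h2 : inner ℝ n x = (M.cell e).offset n := hxn.2
    rw [inner_neg_left] at heq
    linarith

lemma notMem_interior_of_mem {x : E d} {e e' : Fin M.numCells} (hne : e' ≠ e)
    (hx : x ∈ M.K e) : x ∉ interior (M.K e') := by
  intro h
  have hx' : x ∈ closure (interior (M.cell e).carrier) := by
    rw [Polytope.closure_interior_carrier]; exact hx
  obtain ⟨y, hy1, hy2⟩ := mem_closure_iff.1 hx' _ isOpen_interior h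
  exact Set.disjoint_left.1 (M.disjoint e' e hne) hy1 hy2

/-- Off the skeleton, a second cell that contains a point of a facet has the opposite facet
there. -/
lemma neg_mem_normals_of_mem {x : E d} (hx : x ∉ M.skeleton) {e e' : Fin M.numCells}
    (hne : e' ≠ e) {n : E d} (hn : n ∈ (M.cell e).normals) (hxn : x ∈ (M.cell e).facet n)
    (hxe' : x ∈ M.K e') : -n ∈ (M.cell e').normals ∧ x ∈ (M.cell e').facet (-n) := by
  obtain ⟨m, hm, hxm⟩ := Polytope.exists_mem_facet hxe' (notMem_interior_of_mem hne hxn.1)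
  rcases eq_or_eq_neg_of_notMem_skeleton hx hn hm hxn hxm with h | h
  · subst h
    obtain ⟨t, h1, h2⟩ :=
      (((regularAt_of_notMem_skeleton hx hn hxn).eventually_sub_mem_interior hn).and
      ((regularAt_of_notMem_skeleton hx hm hxm).eventually_sub_mem_interior hm)).exists
    exact absurd h2 (Set.disjoint_left.1 (M.disjoint e e' hne.symm) h1)
  · subst h; exact ⟨hm, hxm⟩

/-- Off the skeleton, a facet point belongs to at most one further cell. -/
lemma eq_of_mem_of_mem {x : E d} (hx : x ∉ M.skeleton) {e e₁ e₂ : Fin M.numCells}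
    (h₁ : e₁ ≠ e) (h₂ : e₂ ≠ e) {n : E d} (hn : n ∈ (M.cell e).normals)
    (hxn : x ∈ (M.cell e).facet n) (hx₁ : x ∈ M.K e₁) (hx₂ : x ∈ M.K e₂) : e₁ = e₂ := by
  by_contra hne
  obtain ⟨a1, b1⟩ := neg_mem_normals_of_mem hx h₁ hn hxn hx₁
  obtain ⟨a2, b2⟩ := neg_mem_normals_of_mem hx h₂ hn hxn hx₂
  obtain ⟨t, c1, c2⟩ :=
    (((regularAt_of_notMem_skeleton hx a1 b1).eventually_sub_mem_interior a1).and
    ((regularAt_of_notMem_skeleton hx a2 b2).eventually_sub_mem_interior a2)).exists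
  exact Set.disjoint_left.1 (M.disjoint e₁ e₂ hne) c1 c2

lemma K_subset_closure (e : Fin M.numCells) : M.K e ⊆ closure Ω := by
  rw [← M.iUnion_eq]
  exact Set.subset_iUnion (fun e => (M.cell e).carrier) e

lemma interior_K_subset (hΩ : interior (closure Ω) = Ω) (e : Fin M.numCells) :
    interior (M.K e) ⊆ Ω :=
  (interior_mono (K_subset_closure e)).trans hΩ.subset

/-- Off the skeleton, a facet point lies on the boundary of the domain if and only if it belongs to
no further cell. -/
lemma mem_frontier_iff (hΩ : interior (closure Ω) = Ω) {x : E d} (hx : x ∉ M.skeleton)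
    {e : Fin M.numCells} {n : E d} (hn : n ∈ (M.cell e).normals)
    (hxn : x ∈ (M.cell e).facet n) : x ∈ frontier Ω ↔ ∀ e' ≠ e, x ∉ M.K e' := by
  have hopen : IsOpen Ω := hΩ ▸ isOpen_interior
  have hreg := regularAt_of_notMem_skeleton hx hn hxn
  constructor
  · intro hfr e' hne hxe'
    obtain ⟨a1, b1⟩ := neg_mem_normals_of_mem hx hne hn hxn hxe'
    have hreg' := regularAt_of_notMem_skeleton hx a1 b1
    refine hfr.2 ?_
    rw [hopen.interior_eq, ← hΩ, mem_interior_iff_mem_nhds]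
    filter_upwards [hreg.eventually_mem, hreg'.eventually_mem] with y h1 h2
    rcases le_total (inner ℝ n y) (inner ℝ n x) with h | h
    · exact K_subset_closure e (h1 h)
    · refine K_subset_closure e' (h2 ?_)
      rw [inner_neg_left, inner_neg_left]
      linarith
  · intro hno
    refine ⟨K_subset_closure e hxn.1, fun hint => ?_⟩
    have hcl : IsClosed (⋃ e' ∈ {e' | e' ≠ e}, M.K e') :=
      (Set.toFinite _).isClosed_biUnion fun e' _ => (M.cell e').isClosed_carrier
    have hnot : x ∉ ⋃ e' ∈ {e' | e' ≠ e}, M.K e' := by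
      simpa using hno
    have ht := Polytope.tendsto_sub_smul x (-n)
    obtain ⟨t, ⟨h1, h2⟩, h3⟩ := (((ht.eventually (hcl.isOpen_compl.mem_nhds hnot)).and
      (ht.eventually (mem_interior_iff_mem_nhds.1 hint))).and self_mem_nhdsWithin).exists
    have h4 : x - t • -n ∈ ⋃ e, (M.cell e).carrier := by
      rw [M.iUnion_eq]; exact subset_closure h2
    obtain ⟨e', he'⟩ := Set.mem_iUnion.1 h4
    by_cases hee : e' = e
    · subst hee
      have h5 := Polytope.inner_sub_smul_lt (n := -n)
        (by rw [norm_neg]; exact (M.cell e').norm_eq_one n hn) x h3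
      have h6 := he' n hn
      have h7 : inner ℝ n x = (M.cell e').offset n := hxn.2
      rw [inner_neg_left, inner_neg_left] at h5
      linarith
    · exact h1 (Set.mem_biUnion hee he')

/-- The value on the side `K⁻` of a face of a quantity `G e n x` attached to the facets of the
cells; it is zero on the boundary of the domain. -/
def sideMinus (G : Fin M.numCells → E d → E d → ℝ) (F : Face d M.numCells) (x : E d) : ℝ :=
  match F.minus with
  | none => 0
  | some e' => G e' (-F.normal) x

/-- All oriented face candidates, listed once each, including those of measure zero. -/
noncomputable def candidates (M : Mesh d Ω) : Finset (Face d M.numCells) := by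
  classical exact
  ((Finset.univ : Finset (Fin M.numCells × Option (Fin M.numCells))).sigma
    fun q => (M.cell q.1).normals).filter fun F => ∀ e', F.minus = some e' → F.plus < e'

lemma isClosed_faceSet (F : Face d M.numCells) : IsClosed (M.faceSet F) := by
  refine ((M.cell F.plus).isClosed_facet _).inter ?_
  rcases F.minus with _ | e'
  · exact isClosed_frontier
  · exact (M.cell e').isClosed_carrier

lemma faceSet_subset (F : Face d M.numCells) :
    M.faceSet F ⊆ (M.cell F.plus).facet F.normal := Set.inter_subset_left

open Classical in
/-- Off the skeleton, the faces through a point match the facets through it. -/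
lemma sum_indicator_faceSet (hΩ : interior (closure Ω) = Ω) {x : E d} (hx : x ∉ M.skeleton)
    (G : Fin M.numCells → E d → E d → ℝ) :
    ∑ F ∈ M.candidates,
        (M.faceSet F).indicator (fun x => G F.plus F.normal x + sideMinus G F x) x
      = ∑ e, ∑ n ∈ (M.cell e).normals, ((M.cell e).facet n).indicator (G e n) x := by
  -- the sides of the interior faces, written with the cell `e` and a neighbour `e'`
  set A : Fin M.numCells → E d → Fin M.numCells → Prop := fun e n e' =>
    x ∈ (M.cell e).facet n ∧ x ∈ M.K e' with hA
  have hL : ∑ F ∈ M.candidates,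
        (M.faceSet F).indicator (fun x => G F.plus F.normal x + sideMinus G F x) x
      = ∑ e, ((∑ n ∈ (M.cell e).normals,
            if x ∈ (M.cell e).facet n ∧ x ∈ frontier Ω then G e n x else 0)
          + ∑ e', ∑ n ∈ (M.cell e).normals, if e < e' then
              (if A e n e' then G e n x + G e' (-n) x else 0) else 0) := by
    rw [candidates, Finset.sum_filter, Finset.sum_sigma, Fintype.sum_prod_type]
    refine Finset.sum_congr rfl fun e _ => ?_
    rw [Fintype.sum_option]
    congr 1
    · refine Finset.sum_congr rfl fun n _ => ?_
      simp [Face.minus, Face.plus, Face.normal, sideMinus, faceSet, Set.indicator_apply]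
    · refine Finset.sum_congr rfl fun e' _ => Finset.sum_congr rfl fun n _ => ?_
      simp [Face.minus, Face.plus, Face.normal, sideMinus, faceSet, Set.indicator_apply, hA]
  have hswap : ∀ e e', e < e' →
      ∑ n ∈ (M.cell e).normals, (if A e n e' then G e' (-n) x else 0)
        = ∑ n ∈ (M.cell e').normals, (if A e' n e then G e' n x else 0) := by
    intro e e' hlt
    rw [← Finset.sum_filter, ← Finset.sum_filter]
    refine Finset.sum_nbij' (fun n => -n) (fun n => -n) ?_ ?_ ?_ ?_ ?_
    · intro n hn
      rw [Finset.mem_filter] at hn ⊢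
      obtain ⟨a, b⟩ := neg_mem_normals_of_mem hx hlt.ne' hn.1 hn.2.1 hn.2.2
      exact ⟨a, b, hn.2.1.1⟩
    · intro n hn
      rw [Finset.mem_filter] at hn ⊢
      obtain ⟨a, b⟩ := neg_mem_normals_of_mem hx hlt.ne hn.1 hn.2.1 hn.2.2
      exact ⟨a, b, hn.2.1.1⟩
    · intro n _; exact neg_neg n
    · intro n _; exact neg_neg n
    · intro n _; rfl
  have hsplit : ∑ e, ∑ e', ∑ n ∈ (M.cell e).normals, (if e < e' then
              (if A e n e' then G e n x + G e' (-n) x else 0) else 0)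
      = ∑ e, ∑ e', ∑ n ∈ (M.cell e).normals,
          (if e ≠ e' ∧ A e n e' then G e n x else 0) := by
    have h1 : ∀ e e', ∑ n ∈ (M.cell e).normals, (if e < e' then
              (if A e n e' then G e n x + G e' (-n) x else 0) else 0)
        = (∑ n ∈ (M.cell e).normals, if e < e' ∧ A e n e' then G e n x else 0)
          + ∑ n ∈ (M.cell e').normals, if e < e' ∧ A e' n e then G e' n x else 0 := by
      intro e e'
      by_cases h : e < e'
      · simp only [h, if_true, true_and]
        rw [← hswap e e' h, ← Finset.sum_add_distrib]
        refine Finset.sum_congr rfl fun n _ => ?_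
        split_ifs <;> simp
      · simp [h]
    simp_rw [h1, Finset.sum_add_distrib]
    rw [Finset.sum_comm (f := fun e e' =>
      ∑ n ∈ (M.cell e').normals, if e < e' ∧ A e' n e then G e' n x else 0)]
    simp_rw [← Finset.sum_add_distrib]
    refine Finset.sum_congr rfl fun e _ => Finset.sum_congr rfl fun e' _ =>
      Finset.sum_congr rfl fun n _ => ?_
    rcases lt_trichotomy e e' with h | h | h
    · simp [h, h.ne, h.not_gt]
    · simp [h]
    · simp [h, h.ne', h.not_gt]
  rw [hL, Finset.sum_add_distrib, hsplit, ← Finset.sum_add_distrib]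
  refine Finset.sum_congr rfl fun e _ => ?_
  rw [Finset.sum_comm, ← Finset.sum_add_distrib]
  refine Finset.sum_congr rfl fun n hn => ?_
  by_cases hxn : x ∈ (M.cell e).facet n
  · have hfr := mem_frontier_iff hΩ hx hn hxn
    rw [Set.indicator_of_mem hxn]
    by_cases hex : ∃ e' ≠ e, x ∈ M.K e'
    · obtain ⟨e', hne, hxe'⟩ := hex
      have hnf : x ∉ frontier Ω := fun h => hfr.1 h e' hne hxe'
      rw [if_neg (fun h => hnf h.2), zero_add, Finset.sum_eq_single e']
      · rw [if_pos ⟨hne.symm, hxn, hxe'⟩]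
      · intro e'' _ hne''
        refine if_neg fun h => hne'' ?_
        exact eq_of_mem_of_mem hx h.1.symm hne hn hxn h.2.2 hxe'
      · exact fun h => absurd (Finset.mem_univ _) h
    · push Not at hex
      rw [if_pos ⟨hxn, hfr.2 hex⟩, Finset.sum_eq_zero, add_zero]
      intro e' _
      exact if_neg fun h => hex e' h.1.symm h.2.2
  · rw [Set.indicator_of_notMem hxn, if_neg fun h => hxn h.1, zero_add]
    exact Finset.sum_eq_zero fun e' _ => if_neg fun h => hxn h.2.1

lemma mem_normals_of_mem_candidates {F : Face d M.numCells} (hF : F ∈ M.candidates) :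
    F.normal ∈ (M.cell F.plus).normals := by
  rw [candidates, Finset.mem_filter, Finset.mem_sigma] at hF
  exact hF.1.2

lemma mem_candidates_of_mem_faces {F : Face d M.numCells} (hF : F ∈ M.faces) :
    F ∈ M.candidates := by
  rw [faces, Finset.mem_filter] at hF
  rw [candidates, Finset.mem_filter]
  exact ⟨hF.1, hF.2.1⟩

lemma faceSet_subset_K_minus {F : Face d M.numCells} {e' : Fin M.numCells}
    (h : F.minus = some e') : M.faceSet F ⊆ M.K e' := by
  unfold faceSet
  rw [h]
  exact Set.inter_subset_right

lemma continuousOn_sideMinus {G : Fin M.numCells → E d → E d → ℝ}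
    (hG : ∀ e n, ContinuousOn (G e n) (M.K e)) (F : Face d M.numCells) :
    ContinuousOn (sideMinus G F) (M.faceSet F) := by
  rcases h : F.minus with _ | e'
  · have : sideMinus G F = fun _ => 0 := by funext x; simp [sideMinus, h]
    rw [this]; exact continuousOn_const
  · have : sideMinus G F = G e' (-F.normal) := by funext x; simp [sideMinus, h]
    rw [this]; exact (hG e' _).mono (faceSet_subset_K_minus h)

/-- Summing the traces from both sides over the faces is summing over the boundaries of the
cells. -/
theorem sum_faces_eq_sum_facets (hΩ : interior (closure Ω) = Ω)
    {G : Fin M.numCells → E d → E d → ℝ} (hG : ∀ e n, ContinuousOn (G e n) (M.K e)) :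
    ∑ F ∈ M.faces, M.faceIntegral F (fun x => G F.plus F.normal x + sideMinus G F x)
      = ∑ e, ∑ n ∈ (M.cell e).normals, ∫ x in (M.cell e).facet n, G e n x ∂(surf d) := by
  have hmeas : ∀ F : Face d M.numCells, MeasurableSet (M.faceSet F) := fun F =>
    (isClosed_faceSet F).measurableSet
  have hint : ∀ F ∈ M.candidates, IntegrableOn
      (fun x => G F.plus F.normal x + sideMinus G F x) (M.faceSet F) (surf d) := fun F hF =>
    (M.cell F.plus).integrableOn_facet (mem_normals_of_mem_candidates hF) (isClosed_faceSet F)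
      (faceSet_subset F) (((hG _ _).mono fun x hx => hx.1.1).add (continuousOn_sideMinus hG F))
  have hmeas' : ∀ e n, MeasurableSet ((M.cell e).facet n) := fun e n =>
    ((M.cell e).isClosed_facet n).measurableSet
  have hint' : ∀ e, ∀ n ∈ (M.cell e).normals,
      IntegrableOn (G e n) ((M.cell e).facet n) (surf d) := fun e n hn =>
    (M.cell e).integrableOn_facet hn ((M.cell e).isClosed_facet n) subset_rfl
      ((hG e n).mono ((M.cell e).facet_subset_carrier n))
  have h1 : ∑ F ∈ M.faces, M.faceIntegral F (fun x => G F.plus F.normal x + sideMinus G F x)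
      = ∑ F ∈ M.candidates,
        ∫ x in M.faceSet F, G F.plus F.normal x + sideMinus G F x ∂(surf d) := by
    refine Finset.sum_subset (fun F hF => mem_candidates_of_mem_faces hF) fun F hF hF' => ?_
    have h0 : surf d (M.faceSet F) = 0 := by
      by_contra h
      refine hF' ?_
      rw [candidates, Finset.mem_filter] at hF
      rw [faces, Finset.mem_filter]
      exact ⟨hF.1, hF.2, pos_iff_ne_zero.2 h⟩
    exact setIntegral_measure_zero _ h0
  rw [h1]
  simp_rw [← integral_indicator (hmeas _), ← integral_indicator (hmeas' _ _)]
  rw [← integral_finsetSum _ fun F hF => (integrable_indicator_iff (hmeas F)).2 (hint F hF)]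
  have h2 : ∀ e, ∑ n ∈ (M.cell e).normals,
        ∫ x, ((M.cell e).facet n).indicator (fun x => G e n x) x ∂(surf d)
      = ∫ x, ∑ n ∈ (M.cell e).normals, ((M.cell e).facet n).indicator (G e n) x ∂(surf d) :=
    fun e => (integral_finsetSum _ fun n hn =>
      (integrable_indicator_iff (hmeas' e n)).2 (hint' e n hn)).symm
  simp_rw [h2]
  rw [← integral_finsetSum _ fun e _ => integrable_finsetSum _ fun n hn =>
      (integrable_indicator_iff (hmeas' e n)).2 (hint' e n hn)]
  refine integral_congr_ae ?_
  filter_upwards [measure_eq_zero_iff_ae_notMem.1 M.surf_skeleton] with x hx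
  exact sum_indicator_faceSet hΩ hx G

end Mesh

open MvPolynomial

/-! ### Polynomials: scaling and equivalence of norms -/

section Polynomials

variable {d : ℕ}

lemma fderiv_val (q : MvPolynomial (Fin d) ℝ) (x : E d) (i : Fin d) :
    fderiv ℝ (val q) x (EuclideanSpace.single i 1) = val (pderiv i q) x := by
  rw [(hasGradientAt_val q x).hasFDerivAt.fderiv, InnerProductSpace.toDual_apply_apply,
    EuclideanSpace.inner_single_right]
  simp [grad]

lemma val_add (q r : MvPolynomial (Fin d) ℝ) (x : E d) : val (q + r) x = val q x + val r x :=
  map_add _ _ _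

lemma val_mul (q r : MvPolynomial (Fin d) ℝ) (x : E d) : val (q * r) x = val q x * val r x :=
  map_mul _ _ _

lemma val_C (a : ℝ) (x : E d) : val (C a : MvPolynomial (Fin d) ℝ) x = a := eval_C _

lemma val_X (i : Fin d) (x : E d) : val (X i : MvPolynomial (Fin d) ℝ) x = x i := eval_X _

lemma contDiff_val (q : MvPolynomial (Fin d) ℝ) : ContDiff ℝ ∞ (val q) := by
  induction q using MvPolynomial.induction_on with
  | C a =>
    have h : val (C a : MvPolynomial (Fin d) ℝ) = fun _ => a := by funext x; exact val_C a x
    rw [h]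
    exact contDiff_const
  | add q r hq hr =>
    have h : val (q + r) = fun x => val q x + val r x := by funext x; exact val_add q r x
    rw [h]
    exact hq.add hr
  | mul_X q i hq =>
    have hX : ContDiff ℝ ∞ fun x : E d => x i :=
      (EuclideanSpace.proj i : E d →L[ℝ] ℝ).contDiff
    have h : val (q * X i) = fun x => val q x * x i := by funext x; rw [val_mul, val_X]
    rw [h]
    exact hq.mul hX

lemma continuous_val (q : MvPolynomial (Fin d) ℝ) : Continuous (val q) :=
  (contDiff_val q).continuous

lemma continuous_grad (q : MvPolynomial (Fin d) ℝ) : Continuous (grad q) := by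
  unfold grad
  exact (PiLp.continuous_toLp 2 _).comp (continuous_pi fun i => continuous_val _)

lemma norm_grad_sq (q : MvPolynomial (Fin d) ℝ) (x : E d) :
    ‖grad q x‖ ^ 2 = ∑ i, val (pderiv i q) x ^ 2 := by
  rw [EuclideanSpace.real_norm_sq_eq]
  rfl

lemma totalDegree_pderiv_le (i : Fin d) (q : MvPolynomial (Fin d) ℝ) :
    (pderiv i q).totalDegree ≤ q.totalDegree := by
  rw [← mem_restrictTotalDegree]
  nth_rewrite 2 [q.as_sum]
  rw [map_sum]
  refine Submodule.sum_mem _ fun s hs => ?_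
  rw [pderiv_monomial, mem_restrictTotalDegree]
  refine (totalDegree_monomial_le _ _).trans (le_trans ?_ (le_totalDegree hs))
  exact Finsupp.degree_mono (show s - Finsupp.single i 1 ≤ s from tsub_le_self)

lemma localSpace_le (p : ℕ) (hd : 1 ≤ d) (k : SpaceKind) :
    localSpace d p k ≤ restrictTotalDegree (Fin d) ℝ (d * p) := by
  intro q hq
  rcases k with _ | _
  · have h := (mem_restrictTotalDegree _ _ _).1 hq
    exact (mem_restrictTotalDegree _ _ _).2 (h.trans (Nat.le_mul_of_pos_left p hd))
  · have h := (mem_restrictDegree _ _ _).1 hq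
    refine (mem_restrictTotalDegree _ _ _).2 (Finset.sup_le fun s hs => ?_)
    rw [Finsupp.sum_fintype _ _ fun _ => rfl]
    calc ∑ i, s i ≤ ∑ _i : Fin d, p := Finset.sum_le_sum fun i _ => h s hs i
      _ = d * p := by simp

/-- Polynomials of bounded total degree are stable under `y ↦ x₀ + h y`. -/
lemma exists_rescale {N : ℕ} {q : MvPolynomial (Fin d) ℝ}
    (hq : q ∈ restrictTotalDegree (Fin d) ℝ N) (x₀ : E d) (h : ℝ) :
    ∃ r ∈ restrictTotalDegree (Fin d) ℝ N, ∀ y, val r y = val q (x₀ + h • y) := by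
  refine ⟨∑ s ∈ q.support, C (q.coeff s) * ∏ i, (C (x₀ i) + C h * X i) ^ s i, ?_, fun y => ?_⟩
  · refine Submodule.sum_mem _ fun s hs => (mem_restrictTotalDegree _ _ _).2 ?_
    have h1 : ∀ i, (C (x₀ i) + C h * X i : MvPolynomial (Fin d) ℝ).totalDegree ≤ 1 := by
      intro i
      refine (totalDegree_add _ _).trans (max_le (by simp) ?_)
      exact (totalDegree_mul _ _).trans (by simp)
    refine (totalDegree_mul _ _).trans ?_
    rw [totalDegree_C, zero_add]
    refine (totalDegree_finsetProd _ _).trans (le_trans ?_ ((mem_restrictTotalDegree _ _ _).1 hq))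
    refine le_trans (Finset.sum_le_sum fun i _ => (totalDegree_pow _ _).trans
      (Nat.mul_le_mul_left (s i) (h1 i))) ?_
    have h2 := le_totalDegree hs
    rw [Finsupp.sum_fintype _ _ fun _ => rfl] at h2
    simpa using h2
  · have e : val q (x₀ + h • y) = ∑ s ∈ q.support, q.coeff s * ∏ i, (x₀ i + h * y i) ^ s i := by
      unfold val
      rw [eval_eq']
      simp
    rw [e]
    unfold val
    simp [map_sum, map_prod]

/-- Equivalence of norms on polynomials of bounded degree: the maximum over the unit ball is
controlled by the `L²`-norm over a smaller or larger ball. -/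
lemma exists_sq_le_integral_ball (d N : ℕ) {r : ℝ} (hr : 0 < r) :
    ∃ c : ℝ, 0 < c ∧ ∀ q ∈ restrictTotalDegree (Fin d) ℝ N, ∀ y ∈ Metric.closedBall (0 : E d) 1,
      val q y ^ 2 ≤ c * ∫ x in Metric.ball (0 : E d) r, val q x ^ 2 := by
  set μ : Measure (E d) := volume.restrict (Metric.ball 0 r) with hμ
  have hfin : IsFiniteMeasure μ :=
    ⟨by rw [hμ, Measure.restrict_apply_univ]; exact measure_ball_lt_top⟩
  set S := restrictTotalDegree (Fin d) ℝ N with hS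
  have hmem : ∀ q : MvPolynomial (Fin d) ℝ, MemLp (val q) 2 μ := by
    intro q
    obtain ⟨B, hB⟩ := (isCompact_closedBall (0 : E d) r).exists_bound_of_continuousOn
      (continuous_val q).continuousOn
    refine MemLp.of_bound (continuous_val q).aestronglyMeasurable B ?_
    rw [hμ, ae_restrict_iff' Metric.isOpen_ball.measurableSet]
    exact Eventually.of_forall fun x hx => hB x (Metric.ball_subset_closedBall hx)
  let L : S →ₗ[ℝ] Lp ℝ 2 μ :=
    { toFun := fun q => (hmem q).toLp
      map_add' := fun q r => by
        rw [← MemLp.toLp_add]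
        exact MemLp.toLp_congr _ _ (Eventually.of_forall fun x => val_add _ _ x)
      map_smul' := fun a q => by
        rw [RingHom.id_apply, ← MemLp.toLp_const_smul]
        refine MemLp.toLp_congr _ _ (Eventually.of_forall fun x => ?_)
        simp [val, MvPolynomial.smul_eval] }
  let A : S →ₗ[ℝ] C(Metric.closedBall (0 : E d) 1, ℝ) :=
    { toFun := fun q => ⟨fun y => val q y.1, (continuous_val _).comp continuous_subtype_val⟩
      map_add' := fun q r => by ext y; exact val_add _ _ _
      map_smul' := fun a q => by ext y; simp [val, MvPolynomial.smul_eval] }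
  have hinj : Function.Injective L := by
    rw [injective_iff_map_eq_zero]
    intro q hq
    have h1 : (fun x => val q.1 x) =ᵐ[μ] 0 := by
      have := (MemLp.coeFn_toLp (hmem q.1)).symm
      refine this.trans ?_
      have hq' : (hmem q.1).toLp = 0 := hq
      rw [hq']
      exact Lp.coeFn_zero _ _ _
    have h2 : Set.EqOn (val q.1) 0 (Metric.ball 0 r) :=
      Measure.eqOn_open_of_ae_eq h1 Metric.isOpen_ball (continuous_val _).continuousOn
        continuousOn_const
    have h3 : q.1 = 0 := by
      -- the ball contains a box with infinite sides
      obtain ⟨δ, hδ, hsub⟩ : ∃ δ > 0, ∀ x : Fin d → ℝ, (∀ i, x i ∈ Set.Ioo 0 δ) →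
          WithLp.toLp 2 x ∈ Metric.ball (0 : E d) r := by
        have hc : Continuous (fun x : Fin d → ℝ => (WithLp.toLp 2 x : E d)) :=
          PiLp.continuous_toLp 2 _
        have hn : (fun x : Fin d → ℝ => (WithLp.toLp 2 x : E d)) ⁻¹' Metric.ball 0 r
            ∈ 𝓝 (0 : Fin d → ℝ) :=
          (Metric.isOpen_ball.preimage hc).mem_nhds (by simpa using hr)
        obtain ⟨δ, hδ, hb⟩ := Metric.mem_nhds_iff.1 hn
        refine ⟨δ, hδ, fun x hx => hb ?_⟩
        rw [mem_ball_zero_iff, pi_norm_lt_iff hδ]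
        intro i
        rw [Real.norm_eq_abs, abs_of_pos (hx i).1]
        exact (hx i).2
      refine MvPolynomial.funext_set (fun _ => Set.Ioo (0 : ℝ) δ)
        (fun _ => Set.Ioo_infinite hδ) fun x hx => ?_
      rw [map_zero]
      exact h2 (hsub x fun i => hx i (Set.mem_univ i))
    exact Subtype.ext h3
  -- `A` factors through the finite-dimensional range of `L`, where every linear map is bounded
  let eqv := LinearEquiv.ofInjective L hinj
  let T : LinearMap.range L →ₗ[ℝ] C(Metric.closedBall (0 : E d) 1, ℝ) :=
    A.comp eqv.symm.toLinearMap
  have hfd : FiniteDimensional ℝ (LinearMap.range L) := inferInstance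
  obtain ⟨c, hc, hT⟩ := (LinearMap.toContinuousLinearMap T).bound
  refine ⟨c ^ 2, by positivity, fun q hq y hy => ?_⟩
  have h1 := hT (eqv ⟨q, hq⟩)
  have h2 : LinearMap.toContinuousLinearMap T (eqv ⟨q, hq⟩) = A ⟨q, hq⟩ := by
    simp [T]
  rw [h2] at h1
  have h3 : |val q y| ≤ ‖A ⟨q, hq⟩‖ := (A ⟨q, hq⟩).norm_coe_le_norm ⟨y, hy⟩
  have h4 : ‖eqv ⟨q, hq⟩‖ ^ 2 = ∫ x in Metric.ball (0 : E d) r, val q x ^ 2 := by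
    have e1 : ‖eqv ⟨q, hq⟩‖ = ‖(hmem q).toLp‖ := rfl
    rw [e1, ← real_inner_self_eq_norm_sq, L2.inner_def]
    refine integral_congr_ae ?_
    filter_upwards [(hmem q).coeFn_toLp] with x hx
    rw [hx]
    simp [pow_two]
  rw [← h4, ← mul_pow, ← sq_abs]
  exact pow_le_pow_left₀ (abs_nonneg _) (h3.trans h1) 2

end Polynomials

/-! ### The discrete trace inequality -/

/-- Perimeter bound: by the divergence theorem for `x - x₀`, a polytope that contains a ball of
radius `ρ` has perimeter at most `d / ρ` times its volume. -/
lemma Polytope.perimeter_le {d : ℕ} (K : Polytope d) {x₀ : E d} {ρ : ℝ} (hρ : 0 < ρ)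
    (hK : Metric.ball x₀ ρ ⊆ K.carrier) :
    ρ * ∑ n ∈ K.normals, (surf d).real (K.facet n) ≤ d * volume.real K.carrier := by
  have hw : ∀ i : Fin d, HasWeakPartial (Set.univ : Set (E d)) i (fun _ => 1) (fun _ => 0) := by
    intro i φ hφ hφc _
    have hd : Continuous fun x => fderiv ℝ φ x (EuclideanSpace.single i 1) :=
      (hφ.continuous_fderiv (by simp)).clm_apply continuous_const
    have h := integral_mul_fderiv_eq_neg_fderiv_mul_of_integrable
      (μ := (volume : Measure (E d))) (f := fun _ => (1 : ℝ)) (g := φ)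
      (v := EuclideanSpace.single i 1) (by simp)
      (by
        simp only [one_mul]
        exact hd.integrable_of_hasCompactSupport (hφc.fderiv_apply ℝ _))
      (by
        simp only [one_mul]
        exact hφ.continuous.integrable_of_hasCompactSupport hφc)
      (fun x _ => by fun_prop) (fun x _ => hφ.differentiable (by simp) x)
    simpa using h
  have hdiv : ∀ i : Fin d, volume.real K.carrier
      = ∑ n ∈ K.normals, n i * ∫ x in K.facet n, (x i - x₀ i) ∂(surf d) := by
    intro i
    have hφ : ContDiff ℝ ∞ fun x : E d => x i - x₀ i :=
      (EuclideanSpace.proj i : E d →L[ℝ] ℝ).contDiff.sub contDiff_const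
    have h := K.integral_mul_fderiv_add_eq_sum_facet (Set.subset_univ _) (hw i)
      continuousOn_const integrableOn_zero hφ
    have hfd : ∀ x, fderiv ℝ (fun x : E d => x i - x₀ i) x (EuclideanSpace.single i 1) = 1 := by
      intro x
      have := ((EuclideanSpace.proj i : E d →L[ℝ] ℝ).hasFDerivAt (x := x)).sub_const (x₀ i)
      have h' : HasFDerivAt (fun x : E d => x i - x₀ i) (EuclideanSpace.proj i : E d →L[ℝ] ℝ) x :=
        this
      rw [h'.fderiv]
      simp
    simpa [hfd] using h
  have hsum : (d : ℝ) * volume.real K.carrier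
      = ∑ n ∈ K.normals, ∫ x in K.facet n, inner ℝ n (x - x₀) ∂(surf d) := by
    have h1 : (d : ℝ) * volume.real K.carrier = ∑ _i : Fin d, volume.real K.carrier := by simp
    rw [h1, Finset.sum_congr rfl fun i _ => hdiv i, Finset.sum_comm]
    refine Finset.sum_congr rfl fun n hn => ?_
    simp_rw [← integral_const_mul]
    rw [← integral_finsetSum]
    · refine integral_congr_ae (Eventually.of_forall fun x => ?_)
      simp [PiLp.inner_apply, mul_comm]
    · intro i _
      refine K.integrableOn_facet hn (K.isClosed_facet n) subset_rfl (Continuous.continuousOn ?_)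
      fun_prop
  rw [hsum, Finset.mul_sum]
  refine Finset.sum_le_sum fun n hn => ?_
  have hn1 := K.norm_eq_one n hn
  have hx₀ : ρ ≤ K.offset n - inner ℝ n x₀ := by
    refine le_of_forall_lt_imp_le_of_dense fun s hs => ?_
    have hmem : x₀ + max s 0 • n ∈ Metric.ball x₀ ρ := by
      rw [Metric.mem_ball, dist_eq_norm, add_sub_cancel_left, norm_smul, hn1, mul_one,
        Real.norm_of_nonneg (le_max_right _ _)]
      exact max_lt hs hρ
    have h := hK hmem n hn
    rw [inner_add_right, inner_smul_right, inner_self_of_norm_one hn1, mul_one] at h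
    linarith [le_max_left s 0]
  have hle : ∀ x ∈ K.facet n, ρ ≤ inner ℝ n (x - x₀) := by
    intro x hx
    rw [inner_sub_right, show inner ℝ n x = K.offset n from hx.2]
    exact hx₀
  have hi : IntegrableOn (fun x => inner ℝ n (x - x₀)) (K.facet n) (surf d) :=
    K.integrableOn_facet hn (K.isClosed_facet n) subset_rfl (Continuous.continuousOn (by fun_prop))
  have hfin := (K.surf_facet_lt_top hn).ne
  have h := setIntegral_mono_on (integrableOn_const (C := ρ) hfin) hi
    (K.isClosed_facet n).measurableSet hle
  rw [setIntegral_const, smul_eq_mul, mul_comm] at h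
  exact h

/-- The discrete trace inequality `h ‖q‖²_{∂K} ≤ c ‖q‖²_K` for polynomials of degree at most `N`
on polytopes of diameter `h` that contain a ball of radius `ϱ h`. -/
theorem exists_trace_const (d N : ℕ) {ϱ : ℝ} (hϱ : 0 < ϱ) :
    ∃ c : ℝ, 0 < c ∧ ∀ K : Polytope d, (∃ x, Metric.ball x (ϱ * K.diam) ⊆ K.carrier) →
      ∀ q ∈ restrictTotalDegree (Fin d) ℝ N,
        K.diam * ∑ n ∈ K.normals, ∫ x in K.facet n, val q x ^ 2 ∂(surf d)
          ≤ c * ∫ x in K.carrier, val q x ^ 2 := by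
  obtain ⟨c₀, hc₀, hball⟩ := exists_sq_le_integral_ball d N hϱ
  set κ₀ : ℝ := volume.real (Metric.ball (0 : E d) 1) with hκ₀
  refine ⟨d * κ₀ * c₀ / ϱ + 1, by positivity, ?_⟩
  rintro K ⟨x₀, hx₀⟩ q hq
  set h := K.diam with hh
  have hI : 0 ≤ ∫ x in K.carrier, val q x ^ 2 := integral_nonneg fun x => sq_nonneg _
  have hh0 : 0 ≤ h := Metric.diam_nonneg
  rcases hh0.eq_or_lt with h0 | hpos
  · rw [← h0, zero_mul]
    positivity
  have hx₀K : x₀ ∈ K.carrier := hx₀ (Metric.mem_ball_self (by positivity))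
  have hdist : ∀ x ∈ K.carrier, dist x x₀ ≤ h := fun x hx =>
    Metric.dist_le_diam_of_mem K.bounded hx hx₀K
  have hcont : Continuous fun x => val q x ^ 2 := (continuous_val q).pow 2
  have hint : IntegrableOn (fun x => val q x ^ 2) K.carrier :=
    hcont.continuousOn.integrableOn_compact K.isCompact_carrier
  -- the maximum of `q²` over the polytope, by scaling to the unit ball
  have hsup : ∀ x ∈ K.carrier, val q x ^ 2 ≤ c₀ * ((h ^ d)⁻¹ * ∫ x in K.carrier, val q x ^ 2) := by
    intro x hx
    obtain ⟨r, hr, hrq⟩ := exists_rescale hq x₀ h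
    have hy : h⁻¹ • (x - x₀) ∈ Metric.closedBall (0 : E d) 1 := by
      rw [mem_closedBall_zero_iff, norm_smul, norm_inv, Real.norm_of_nonneg hpos.le,
        inv_mul_le_one₀ hpos, ← dist_eq_norm]
      exact hdist x hx
    have h1 := hball r hr _ hy
    rw [hrq, smul_smul, mul_inv_cancel₀ hpos.ne', one_smul, add_sub_cancel] at h1
    refine h1.trans ?_
    have h2 : ∫ y in Metric.ball (0 : E d) ϱ, val r y ^ 2
        = (h ^ d)⁻¹ * ∫ x in Metric.ball x₀ (ϱ * h), val q x ^ 2 := by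
      simp_rw [hrq]
      have e1 := Measure.setIntegral_comp_smul_of_pos (volume : Measure (E d))
        (fun z => val q (x₀ + z) ^ 2) (Metric.ball (0 : E d) ϱ) hpos
      rw [e1, finrank_euclideanSpace_fin, smul_eq_mul, smul_ball hpos.ne', smul_zero,
        Real.norm_of_nonneg hpos.le, mul_comm h ϱ]
      congr 1
      have e2 := (measurePreserving_add_left (volume : Measure (E d)) x₀).setIntegral_preimage_emb
        (measurableEmbedding_addLeft x₀) (fun z => val q z ^ 2) (Metric.ball x₀ (ϱ * h))
      rw [← e2]
      congr 2
      ext z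
      simp
    rw [h2]
    gcongr
    exact Eventually.of_forall fun x => sq_nonneg _
  set I := ∫ x in K.carrier, val q x ^ 2 with hIdef
  have hper := K.perimeter_le (mul_pos hϱ hpos) hx₀
  have hvol : volume.real K.carrier ≤ h ^ d * κ₀ := by
    have e1 : volume.real K.carrier ≤ volume.real (Metric.closedBall x₀ h) :=
      measureReal_mono hdist measure_closedBall_lt_top.ne
    refine e1.trans (le_of_eq ?_)
    rw [measureReal_def, Measure.addHaar_closedBall _ _ hpos.le, ENNReal.toReal_mul,
      ENNReal.toReal_ofReal (by positivity), finrank_euclideanSpace_fin]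
    rfl
  have hfac : ∑ n ∈ K.normals, ∫ x in K.facet n, val q x ^ 2 ∂(surf d)
      ≤ (∑ n ∈ K.normals, (surf d).real (K.facet n)) * (c₀ * ((h ^ d)⁻¹ * I)) := by
    rw [Finset.sum_mul]
    refine Finset.sum_le_sum fun n hn => ?_
    have e := setIntegral_mono_on
      (K.integrableOn_facet hn (K.isClosed_facet n) subset_rfl hcont.continuousOn)
      (integrableOn_const (C := c₀ * ((h ^ d)⁻¹ * I)) (K.surf_facet_lt_top hn).ne)
      (K.isClosed_facet n).measurableSet fun x hx => hsup x hx.1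
    rwa [setIntegral_const, smul_eq_mul] at e
  set Pm := ∑ n ∈ K.normals, (surf d).real (K.facet n) with hPm
  have hP : h * Pm ≤ d * (h ^ d * κ₀) / ϱ := by
    rw [le_div_iff₀ hϱ]
    have : (d : ℝ) * volume.real K.carrier ≤ d * (h ^ d * κ₀) := by gcongr
    linarith
  calc h * ∑ n ∈ K.normals, ∫ x in K.facet n, val q x ^ 2 ∂(surf d)
      ≤ h * (Pm * (c₀ * ((h ^ d)⁻¹ * I))) := by gcongr
    _ = (h * Pm) * (c₀ * ((h ^ d)⁻¹ * I)) := by ring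
    _ ≤ (d * (h ^ d * κ₀) / ϱ) * (c₀ * ((h ^ d)⁻¹ * I)) := by gcongr
    _ = (d * κ₀ * c₀ / ϱ) * I := by
      have : h ^ d ≠ 0 := (pow_pos hpos d).ne'
      field_simp
    _ ≤ (d * κ₀ * c₀ / ϱ + 1) * I := by gcongr; linarith

namespace Mesh

variable {d : ℕ} {Ω : Set (E d)} {M : Mesh d Ω}

/-! ### Length scales and traces on faces -/

lemma mem_normals_of_mem_faces {F : Face d M.numCells} (hF : F ∈ M.faces) :
    F.normal ∈ (M.cell F.plus).normals :=
  mem_normals_of_mem_candidates (mem_candidates_of_mem_faces hF)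

lemma integrableOn_faceSet {F : Face d M.numCells} (hF : F ∈ M.faces) {f : E d → ℝ}
    (hf : ContinuousOn f (M.faceSet F)) : IntegrableOn f (M.faceSet F) (surf d) :=
  (M.cell F.plus).integrableOn_facet (mem_normals_of_mem_faces hF) (isClosed_faceSet F)
    (faceSet_subset F) hf

lemma faceSet_subset_K_plus (F : Face d M.numCells) : M.faceSet F ⊆ M.K F.plus :=
  fun _ hx => hx.1.1

lemma hF_le_h_plus (F : Face d M.numCells) : M.hF F ≤ M.h F.plus := by
  unfold hF
  split_ifs with h
  · rcases F.minus with _ | e'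
    · exact le_rfl
    · exact min_le_left _ _
  · exact Metric.diam_mono (faceSet_subset_K_plus F) (M.cell F.plus).bounded

lemma hF_le_h_minus {F : Face d M.numCells} {e' : Fin M.numCells} (he : F.minus = some e') :
    M.hF F ≤ M.h e' := by
  unfold hF
  split_ifs with h
  · rw [he]
    exact min_le_right _ _
  · exact Metric.diam_mono (faceSet_subset_K_minus he) (M.cell e').bounded

lemma h_pos (hd : 1 ≤ d) (e : Fin M.numCells) : 0 < M.h e := by
  have : Nonempty (Fin d) := ⟨⟨0, hd⟩⟩
  refine Metric.diam_pos ?_ (M.cell e).bounded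
  by_contra hs
  rw [Set.not_nontrivial_iff] at hs
  have h0 := (hs.anti interior_subset).measure_zero (volume : Measure (E d))
  exact (isOpen_interior.measure_pos volume (M.cell e).nonempty_interior_carrier).ne' h0

/-- For `d ≥ 2` a face of positive surface measure is not a single point; for `d = 1` the length
scale is a cell diameter. -/
lemma hF_pos (hd : 1 ≤ d) {F : Face d M.numCells} (hF : F ∈ M.faces) : 0 < M.hF F := by
  unfold Mesh.hF
  split_ifs with h
  · rcases F.minus with _ | e'
    · exact h_pos hd _
    · exact lt_min (h_pos hd _) (h_pos hd _)
  · refine Metric.diam_pos ?_ ((M.cell F.plus).bounded.subset (faceSet_subset_K_plus F))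
    by_contra hs
    rw [Set.not_nontrivial_iff] at hs
    have hpos : 0 < surf d (M.faceSet F) := (Finset.mem_filter.1 hF).2.2
    refine hpos.ne' ?_
    have h1 : (0 : ℝ) < ((d - 1 : ℕ) : ℝ) := by
      have : 0 < d - 1 := by omega
      exact_mod_cast this
    have := Measure.nullSingletonClass_hausdorff (E d) h1
    have h2 : (Measure.hausdorffMeasure ((d - 1 : ℕ) : ℝ) : Measure (E d)) (M.faceSet F) = 0 :=
      hs.measure_zero _
    rw [surf, Measure.euclideanHausdorffMeasure_def, Measure.smul_apply, h2, smul_zero]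

lemma continuous_valMinus (F : Face d M.numCells) (v : Broken d M.numCells) :
    Continuous (valMinus F v) := by
  unfold valMinus
  rcases F.minus with _ | e'
  · exact continuous_const
  · exact continuous_val _

lemma continuous_gradMinus (F : Face d M.numCells) (v : Broken d M.numCells) :
    Continuous (gradMinus F v) := by
  unfold gradMinus
  rcases F.minus with _ | e'
  · exact continuous_grad _
  · exact continuous_grad _

lemma continuous_avgGrad (F : Face d M.numCells) (v : Broken d M.numCells) :
    Continuous (avgGrad F v) := by
  unfold avgGrad
  exact ((continuous_grad _).add (continuous_gradMinus F v)).const_smul (1 / 2 : ℝ)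

lemma continuous_jump (F : Face d M.numCells) (v : Broken d M.numCells) :
    Continuous (jump F v) :=
  ((continuous_val _).smul continuous_const).add ((continuous_valMinus F v).smul continuous_const)

lemma jump_eq (F : Face d M.numCells) (v : Broken d M.numCells) (x : E d) :
    jump F v x = (val (v F.plus) x - valMinus F v x) • F.normal := by
  rw [jump, smul_neg, sub_smul, sub_eq_add_neg]

/-! ### The diffusive part -/

/-- The boundary terms of the gradients are controlled by the volume terms, by the trace
inequality on every cell. -/
lemma sum_faces_grad_le (hΩ : interior (closure Ω) = Ω) {N : ℕ} {c : ℝ}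
    (htr : ∀ e, ∀ q ∈ restrictTotalDegree (Fin d) ℝ N,
        M.h e * ∑ n ∈ (M.cell e).normals, ∫ x in (M.cell e).facet n, val q x ^ 2 ∂(surf d)
          ≤ c * ∫ x in M.K e, val q x ^ 2)
    {v : Broken d M.numCells} (hv : ∀ e, v e ∈ restrictTotalDegree (Fin d) ℝ N) :
    ∑ F ∈ M.faces, M.faceIntegral F (fun x => M.h F.plus * ‖grad (v F.plus) x‖ ^ 2
        + sideMinus (fun e _ x => M.h e * ‖grad (v e) x‖ ^ 2) F x)
      ≤ c * ∑ e, ∫ x in M.K e, ‖grad (v e) x‖ ^ 2 := by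
  have hcont : ∀ e, Continuous fun x => M.h e * ‖grad (v e) x‖ ^ 2 := fun e =>
    continuous_const.mul ((continuous_grad _).norm.pow 2)
  rw [sum_faces_eq_sum_facets hΩ (G := fun e _ x => M.h e * ‖grad (v e) x‖ ^ 2)
    fun e _ => (hcont e).continuousOn, Finset.mul_sum]
  refine Finset.sum_le_sum fun e _ => ?_
  simp_rw [integral_const_mul, norm_grad_sq]
  have hq : ∀ i, Continuous fun x => val (pderiv i (v e)) x ^ 2 := fun i =>
    (continuous_val _).pow 2
  rw [← Finset.mul_sum]
  have e1 : ∑ n ∈ (M.cell e).normals,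
        ∫ x in (M.cell e).facet n, ∑ i, val (pderiv i (v e)) x ^ 2 ∂(surf d)
      = ∑ i, ∑ n ∈ (M.cell e).normals,
          ∫ x in (M.cell e).facet n, val (pderiv i (v e)) x ^ 2 ∂(surf d) := by
    rw [Finset.sum_comm]
    refine Finset.sum_congr rfl fun n hn => integral_finsetSum _ fun i _ => ?_
    exact (M.cell e).integrableOn_facet hn ((M.cell e).isClosed_facet n) subset_rfl
      (hq i).continuousOn
  have e2 : ∫ x in M.K e, ∑ i, val (pderiv i (v e)) x ^ 2
      = ∑ i, ∫ x in M.K e, val (pderiv i (v e)) x ^ 2 :=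
    integral_finsetSum _ fun i _ =>
      (hq i).continuousOn.integrableOn_compact (M.cell e).isCompact_carrier
  rw [e1, e2, Finset.mul_sum, Finset.mul_sum]
  refine Finset.sum_le_sum fun i _ => htr e _ ?_
  exact (mem_restrictTotalDegree _ _ _).2
    ((totalDegree_pderiv_le i _).trans ((mem_restrictTotalDegree _ _ _).1 (hv e)))

/-- The averages are bounded by the traces from both sides, weighted with the cell diameters. -/
lemma hF_mul_norm_avgGrad_sq_le (F : Face d M.numCells) (v : Broken d M.numCells) (x : E d) :
    M.hF F * ‖avgGrad F v x‖ ^ 2 ≤ M.h F.plus * ‖grad (v F.plus) x‖ ^ 2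
        + sideMinus (fun e _ x => M.h e * ‖grad (v e) x‖ ^ 2) F x := by
  have hF0 : 0 ≤ M.hF F := by
    unfold Mesh.hF
    split_ifs
    · rcases F.minus with _ | e'
      · exact Metric.diam_nonneg
      · exact le_min Metric.diam_nonneg Metric.diam_nonneg
    · exact Metric.diam_nonneg
  have h1 := hF_le_h_plus F
  have h2 : ‖avgGrad F v x‖ ^ 2 ≤ (‖grad (v F.plus) x‖ ^ 2 + ‖gradMinus F v x‖ ^ 2) / 2 := by
    have h3 : ‖avgGrad F v x‖ ≤ (‖grad (v F.plus) x‖ + ‖gradMinus F v x‖) / 2 := by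
      rw [avgGrad, norm_smul, Real.norm_of_nonneg (by norm_num)]
      have := norm_add_le (grad (v F.plus) x) (gradMinus F v x)
      linarith
    have h4 := pow_le_pow_left₀ (norm_nonneg _) h3 2
    nlinarith [sq_nonneg (‖grad (v F.plus) x‖ - ‖gradMinus F v x‖)]
  rcases he : F.minus with _ | e'
  · have e1 : gradMinus F v x = grad (v F.plus) x := by simp [gradMinus, he]
    have e2 : sideMinus (fun e _ x => M.h e * ‖grad (v e) x‖ ^ 2) F x = 0 := by
      simp [sideMinus, he]
    rw [e1, add_self_div_two] at h2
    rw [e2, add_zero]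
    exact mul_le_mul h1 h2 (sq_nonneg _) (hF0.trans h1)
  · have e1 : gradMinus F v x = grad (v e') x := by simp [gradMinus, he]
    have e2 : sideMinus (fun e _ x => M.h e * ‖grad (v e) x‖ ^ 2) F x
        = M.h e' * ‖grad (v e') x‖ ^ 2 := by simp [sideMinus, he]
    have h3 := hF_le_h_minus he
    rw [e1] at h2
    rw [e2]
    have a1 : M.hF F * ‖grad (v F.plus) x‖ ^ 2 ≤ M.h F.plus * ‖grad (v F.plus) x‖ ^ 2 := by gcongr
    have a2 : M.hF F * ‖grad (v e') x‖ ^ 2 ≤ M.h e' * ‖grad (v e') x‖ ^ 2 := by gcongr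
    have a3 := mul_le_mul_of_nonneg_left h2 hF0
    have a4 : 0 ≤ M.hF F * ‖grad (v F.plus) x‖ ^ 2 := by positivity
    have a5 : 0 ≤ M.hF F * ‖grad (v e') x‖ ^ 2 := by positivity
    linarith

/-- Coercivity of the interior penalty form up to a Young parameter `t`. -/
lemma sum_faces_diffusion_le (hd : 1 ≤ d) (hΩ : interior (closure Ω) = Ω) {N : ℕ} {c : ℝ}
    (htr : ∀ e, ∀ q ∈ restrictTotalDegree (Fin d) ℝ N,
        M.h e * ∑ n ∈ (M.cell e).normals, ∫ x in (M.cell e).facet n, val q x ^ 2 ∂(surf d)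
          ≤ c * ∫ x in M.K e, val q x ^ 2)
    {v : Broken d M.numCells} (hv : ∀ e, v e ∈ restrictTotalDegree (Fin d) ℝ N)
    (η : ℝ) {t : ℝ} (ht : 0 < t) :
    (∑ F ∈ M.faces, M.faceIntegral F fun x =>
          inner ℝ (avgGrad F v x) (jump F v x) + inner ℝ (avgGrad F v x) (jump F v x)
            - η / M.hF F * inner ℝ (jump F v x) (jump F v x))
      ≤ t * c * (∑ e, ∫ x in M.K e, ‖grad (v e) x‖ ^ 2)
        - (η - 1 / t) * ∑ F ∈ M.faces, 1 / M.hF F * M.faceIntegral F fun x => ‖jump F v x‖ ^ 2 := by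
  set S : Face d M.numCells → E d → ℝ := fun F x => M.h F.plus * ‖grad (v F.plus) x‖ ^ 2
        + sideMinus (fun e _ x => M.h e * ‖grad (v e) x‖ ^ 2) F x with hS
  have hcont : ∀ e, Continuous fun x => M.h e * ‖grad (v e) x‖ ^ 2 := fun e =>
    continuous_const.mul ((continuous_grad _).norm.pow 2)
  have hSc : ∀ F, ContinuousOn (S F) (M.faceSet F) := fun F =>
    (hcont F.plus).continuousOn.add
      (continuousOn_sideMinus (fun e _ => (hcont e).continuousOn) F)
  have hface : ∀ F ∈ M.faces, (M.faceIntegral F fun x =>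
          inner ℝ (avgGrad F v x) (jump F v x) + inner ℝ (avgGrad F v x) (jump F v x)
            - η / M.hF F * inner ℝ (jump F v x) (jump F v x))
      ≤ t * M.faceIntegral F (S F)
        - (η - 1 / t) * (1 / M.hF F * M.faceIntegral F fun x => ‖jump F v x‖ ^ 2) := by
    intro F hF
    have hpos := hF_pos hd hF
    have hJ : Continuous fun x => ‖jump F v x‖ ^ 2 := (continuous_jump F v).norm.pow 2
    have hAJ : Continuous fun x => inner ℝ (avgGrad F v x) (jump F v x) :=
      (continuous_avgGrad F v).inner (continuous_jump F v)
    have hJJ : Continuous fun x => inner ℝ (jump F v x) (jump F v x) :=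
      (continuous_jump F v).inner (continuous_jump F v)
    have i1 := (integrableOn_faceSet hF (hSc F)).const_mul t
    have i2 := (integrableOn_faceSet hF hJ.continuousOn).const_mul ((η - 1 / t) * (1 / M.hF F))
    have e : t * M.faceIntegral F (S F)
        - (η - 1 / t) * (1 / M.hF F * M.faceIntegral F fun x => ‖jump F v x‖ ^ 2)
        = M.faceIntegral F fun x => t * S F x - (η - 1 / t) * (1 / M.hF F) * ‖jump F v x‖ ^ 2 := by
      unfold faceIntegral
      rw [integral_sub i1 i2, integral_const_mul, integral_const_mul]
      ring
    rw [e]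
    refine setIntegral_mono_on ?_ (i1.sub i2) (isClosed_faceSet F).measurableSet fun x _ => ?_
    · exact integrableOn_faceSet hF
        ((hAJ.add hAJ).sub (continuous_const.mul hJJ)).continuousOn
    · have h1 := hF_mul_norm_avgGrad_sq_le F v x
      have h2 := real_inner_le_norm (avgGrad F v x) (jump F v x)
      rw [real_inner_self_eq_norm_sq]
      set A := ‖avgGrad F v x‖
      set J := ‖jump F v x‖
      set k := M.hF F
      -- Young's inequality with weight `t k`
      have h3 : 2 * (A * J) ≤ t * k * A ^ 2 + 1 / t * (1 / k) * J ^ 2 := by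
        have h4 : 0 ≤ (t * k * A - J) ^ 2 / (t * k) := by positivity
        have h5 : (t * k * A - J) ^ 2 / (t * k)
            = t * k * A ^ 2 - 2 * (A * J) + 1 / t * (1 / k) * J ^ 2 := by
          field_simp
          ring
        linarith
      have h6 : t * (k * A ^ 2) ≤ t * S F x := mul_le_mul_of_nonneg_left h1 ht.le
      have h7 : (η - 1 / t) * (1 / k) * J ^ 2 = η / k * J ^ 2 - 1 / t * (1 / k) * J ^ 2 := by ring
      linarith
  refine (Finset.sum_le_sum hface).trans ?_
  rw [Finset.sum_sub_distrib, ← Finset.mul_sum, ← Finset.mul_sum, mul_assoc]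
  exact sub_le_sub_right
    (mul_le_mul_of_nonneg_left (sum_faces_grad_le hΩ htr hv) ht.le) _

/-! ### The convective and reactive parts -/

lemma weakPartial_spec {i : Fin d} {f : E d → ℝ} (hf : MemW1Inf Ω f) :
    MemLInf Ω (weakPartial Ω i f) ∧ HasWeakPartial Ω i f (weakPartial Ω i f) := by
  have h := hf.2 i
  rw [weakPartial, dif_pos h]
  exact h.choose_spec

lemma restrict_K_le (hΩ : interior (closure Ω) = Ω) (e : Fin M.numCells) :
    volume.restrict (M.K e) ≤ volume.restrict Ω := by
  have h := (M.cell e).restrict_interior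
  have h' : volume.restrict (M.K e) = volume.restrict (interior (M.K e)) := h.symm
  rw [h']
  exact Measure.restrict_mono (interior_K_subset hΩ e) le_rfl

lemma integrableOn_K_of_memLInf (hΩ : interior (closure Ω) = Ω) {f : E d → ℝ} (hf : MemLInf Ω f)
    (e : Fin M.numCells) : IntegrableOn f (M.K e) := by
  have h : MemLp f ⊤ (volume.restrict (M.K e)) := hf.mono_measure (restrict_K_le hΩ e)
  have : IsFiniteMeasure (volume.restrict (M.K e)) :=
    ⟨by rw [Measure.restrict_apply_univ]; exact (M.cell e).isCompact_carrier.measure_lt_top⟩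
  exact h.integrable le_top

lemma continuous_component {b : E d → E d} {s : Set (E d)} (hb : ContinuousOn b s) (i : Fin d) :
    ContinuousOn (fun x => b x i) s :=
  (EuclideanSpace.proj i : E d →L[ℝ] ℝ).continuous.comp_continuousOn hb

/-- Integration by parts of the convective term on a cell. -/
lemma two_mul_integral_convection (hΩ : interior (closure Ω) = Ω) {b : E d → E d}
    (hb : ∀ i, MemW1Inf Ω (fun x => b x i)) (hbc : ContinuousOn b (closure Ω))
    (q : MvPolynomial (Fin d) ℝ) (e : Fin M.numCells) :
    2 * (∫ x in M.K e, val q x * inner ℝ (b x) (grad q x))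
        + ∫ x in M.K e, weakDiv Ω b x * val q x ^ 2
      = ∑ n ∈ (M.cell e).normals,
          ∫ x in (M.cell e).facet n, inner ℝ (b x) n * val q x ^ 2 ∂(surf d) := by
  have hbK : ∀ i, ContinuousOn (fun x => b x i) (M.K e) := fun i =>
    continuous_component (hbc.mono (K_subset_closure e)) i
  have hg : ∀ i, IntegrableOn (weakPartial Ω i fun x => b x i) (M.K e) := fun i =>
    integrableOn_K_of_memLInf hΩ (weakPartial_spec (hb i)).1 e
  have hφ : ContDiff ℝ ∞ fun x => val q x ^ 2 := (contDiff_val q).pow 2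
  have hfd : ∀ i x, fderiv ℝ (fun x => val q x ^ 2) x (EuclideanSpace.single i 1)
      = 2 * (val q x * val (pderiv i q) x) := by
    intro i x
    rw [fderiv_fun_pow 2 ((contDiff_val q).differentiable (by simp) x)]
    simp only [smul_apply, smul_eq_mul, fderiv_val]
    simp
    ring
  have hdiv := fun i => (M.cell e).integral_mul_fderiv_add_eq_sum_facet (interior_K_subset hΩ e)
    (weakPartial_spec (hb i)).2 (hbK i) (hg i) hφ
  simp_rw [hfd] at hdiv
  have hsum := Finset.sum_congr (rfl : (Finset.univ : Finset (Fin d)) = Finset.univ)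
    fun i _ => hdiv i
  rw [Finset.sum_add_distrib] at hsum
  have hcK : IsCompact (M.K e) := (M.cell e).isCompact_carrier
  have e1 : ∑ i, ∫ x in (M.cell e).carrier, b x i * (2 * (val q x * val (pderiv i q) x))
      = 2 * ∫ x in M.K e, val q x * inner ℝ (b x) (grad q x) := by
    rw [← integral_finsetSum, ← integral_const_mul]
    · refine integral_congr_ae (Eventually.of_forall fun x => ?_)
      simp only [PiLp.inner_apply, grad, Finset.mul_sum]
      refine Finset.sum_congr rfl fun i _ => ?_
      simp
      ring
    · intro i _
      refine ContinuousOn.integrableOn_compact hcK ((hbK i).mul (Continuous.continuousOn ?_))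
      exact continuous_const.mul ((continuous_val _).mul (continuous_val _))
  have e2 : ∑ i, ∫ x in (M.cell e).carrier, weakPartial Ω i (fun x => b x i) x * val q x ^ 2
      = ∫ x in M.K e, weakDiv Ω b x * val q x ^ 2 := by
    rw [← integral_finsetSum]
    · refine integral_congr_ae (Eventually.of_forall fun x => ?_)
      simp only [weakDiv, Finset.sum_mul]
    · intro i _
      exact (hg i).mul_continuousOn hφ.continuous.continuousOn hcK
  rw [e1, e2] at hsum
  rw [hsum, Finset.sum_comm]
  refine Finset.sum_congr rfl fun n hn => ?_
  simp_rw [← integral_const_mul]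
  rw [← integral_finsetSum]
  · refine integral_congr_ae (Eventually.of_forall fun x => ?_)
    simp only [PiLp.inner_apply, Finset.sum_mul]
    refine Finset.sum_congr rfl fun i _ => ?_
    simp
    ring
  · intro i _
    refine (M.cell e).integrableOn_facet hn ((M.cell e).isClosed_facet n) subset_rfl ?_
    exact continuousOn_const.mul (((hbK i).mono ((M.cell e).facet_subset_carrier n)).mul
      hφ.continuous.continuousOn)

/-- Upwinding dissipates: the upwind fluxes dominate half of the boundary terms produced by
integration by parts, since pointwise the difference is `½ |b · n| (v⁺ - v⁻)²`. -/
lemma half_sum_facets_le_sum_upwind (hΩ : interior (closure Ω) = Ω) {b : E d → E d}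
    (hbc : ContinuousOn b (closure Ω)) (v : Broken d M.numCells) :
    1 / 2 * ∑ e, ∑ n ∈ (M.cell e).normals,
          ∫ x in (M.cell e).facet n, inner ℝ (b x) n * val (v e) x ^ 2 ∂(surf d)
      ≤ ∑ F ∈ M.faces, M.faceIntegral F fun x => inner ℝ (upw F b v x) (jump F v x) := by
  have hG : ∀ e n, ContinuousOn (fun x => inner ℝ (b x) n * val (v e) x ^ 2) (M.K e) := by
    intro e n
    exact ((hbc.mono (K_subset_closure e)).inner continuousOn_const).mul
      ((continuous_val _).pow 2).continuousOn
  rw [← sum_faces_eq_sum_facets hΩ (G := fun e n x => inner ℝ (b x) n * val (v e) x ^ 2) hG,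
    Finset.mul_sum]
  refine Finset.sum_le_sum fun F hF => ?_
  unfold faceIntegral
  rw [← integral_const_mul]
  have hbF : ContinuousOn (fun x => inner ℝ (b x) F.normal) (M.faceSet F) :=
    (hbc.mono ((faceSet_subset_K_plus F).trans (K_subset_closure _))).inner continuousOn_const
  have hside : ∀ x, sideMinus (fun e n x => inner ℝ (b x) n * val (v e) x ^ 2) F x
      = - (inner ℝ (b x) F.normal * valMinus F v x ^ 2) := by
    intro x
    rcases he : F.minus with _ | e'
    · simp [sideMinus, valMinus, he]
    · simp [sideMinus, valMinus, he]
  have hflux : ∀ x, inner ℝ (upw F b v x) (jump F v x)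
      = 1 / 2 * (inner ℝ (b x) F.normal * val (v F.plus) x ^ 2
          + sideMinus (fun e n x => inner ℝ (b x) n * val (v e) x ^ 2) F x)
        + 1 / 2 * |inner ℝ (b x) F.normal| * (val (v F.plus) x - valMinus F v x) ^ 2 := by
    intro x
    rw [hside, upw, jump_eq, inner_smul_left, inner_smul_right]
    simp only [RCLike.conj_to_real]
    split_ifs with h
    · rw [abs_of_nonneg h]; ring
    · rw [abs_of_neg (not_le.1 h)]; ring
  have i1 : IntegrableOn (fun x => 1 / 2 * (inner ℝ (b x) F.normal * val (v F.plus) x ^ 2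
          + sideMinus (fun e n x => inner ℝ (b x) n * val (v e) x ^ 2) F x))
      (M.faceSet F) (surf d) :=
    integrableOn_faceSet hF (continuousOn_const.mul
      (((hG _ _).mono (faceSet_subset_K_plus F)).add (continuousOn_sideMinus hG F)))
  have i2 : IntegrableOn (fun x => 1 / 2 * |inner ℝ (b x) F.normal| *
      (val (v F.plus) x - valMinus F v x) ^ 2) (M.faceSet F) (surf d) :=
    integrableOn_faceSet hF ((continuousOn_const.mul hbF.abs).mul
      (((continuous_val _).sub (continuous_valMinus F v)).pow 2).continuousOn)
  simp_rw [hflux]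
  refine setIntegral_mono_on i1 (i1.add i2) (isClosed_faceSet F).measurableSet fun x _ => ?_
  refine le_add_of_nonneg_right ?_
  positivity

lemma reaction_ge (hΩ : interior (closure Ω) = Ω) {b : E d → E d} {c : E d → ℝ} {σ₀ : ℝ}
    (hb : ∀ i, MemW1Inf Ω (fun x => b x i)) (hc : MemLInf Ω c)
    (hσ : ∀ᵐ x ∂(volume.restrict Ω), σ₀ ≤ c x - 1 / 2 * weakDiv Ω b x)
    (q : MvPolynomial (Fin d) ℝ) (e : Fin M.numCells) :
    σ₀ * (∫ x in M.K e, val q x ^ 2) ≤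
      (∫ x in M.K e, (c x - weakDiv Ω b x) * val q x * val q x)
        + 1 / 2 * ∫ x in M.K e, weakDiv Ω b x * val q x ^ 2 := by
  have hcK : IsCompact (M.K e) := (M.cell e).isCompact_carrier
  have hq : ContinuousOn (fun x => val q x ^ 2) (M.K e) := ((continuous_val q).pow 2).continuousOn
  have i1 : IntegrableOn (fun x => c x * val q x ^ 2) (M.K e) :=
    (integrableOn_K_of_memLInf hΩ hc e).mul_continuousOn hq hcK
  have hdiv : IntegrableOn (weakDiv Ω b) (M.K e) :=
    integrable_finsetSum _ fun i _ => integrableOn_K_of_memLInf hΩ (weakPartial_spec (hb i)).1 e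
  have i2 : IntegrableOn (fun x => weakDiv Ω b x * val q x ^ 2) (M.K e) :=
    hdiv.mul_continuousOn hq hcK
  have e1 : ∀ x, (c x - weakDiv Ω b x) * val q x * val q x
      = c x * val q x ^ 2 - weakDiv Ω b x * val q x ^ 2 := fun x => by ring
  simp_rw [e1]
  rw [integral_sub i1 i2, ← integral_const_mul]
  have h : ∫ x in M.K e, σ₀ * val q x ^ 2
      ≤ ∫ x in M.K e, (c x * val q x ^ 2 - 1 / 2 * (weakDiv Ω b x * val q x ^ 2)) := by
    refine integral_mono_ae ((hq.integrableOn_compact hcK).const_mul _) (i1.sub (i2.const_mul _)) ?_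
    filter_upwards [ae_mono (restrict_K_le hΩ e) hσ] with x hx
    have := mul_le_mul_of_nonneg_right hx (sq_nonneg (val q x))
    linarith
  rw [integral_sub i1 (i2.const_mul _), integral_const_mul (1 / 2 : ℝ)] at h
  linarith

/-- The convective and reactive parts of the form control the weighted `L²`-norm. -/
lemma convection_reaction_ge (hΩ : interior (closure Ω) = Ω) {b : E d → E d} {c : E d → ℝ}
    {σ₀ : ℝ} (hb : ∀ i, MemW1Inf Ω (fun x => b x i)) (hbc : ContinuousOn b (closure Ω))
    (hc : MemLInf Ω c) (hσ : ∀ᵐ x ∂(volume.restrict Ω), σ₀ ≤ c x - 1 / 2 * weakDiv Ω b x)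
    (v : Broken d M.numCells) :
    σ₀ * (∑ e, ∫ x in M.K e, val (v e) x ^ 2) ≤
      - (∑ e, ∫ x in M.K e, val (v e) x * inner ℝ (b x) (grad (v e) x))
      + (∑ F ∈ M.faces, M.faceIntegral F fun x => inner ℝ (upw F b v x) (jump F v x))
      + (∑ e, ∫ x in M.K e, (c x - weakDiv Ω b x) * val (v e) x * val (v e) x) := by
  have h1 := half_sum_facets_le_sum_upwind hΩ hbc v
  rw [← Finset.sum_congr rfl fun e _ => two_mul_integral_convection hΩ hb hbc (v e) e,
    Finset.sum_add_distrib, ← Finset.mul_sum] at h1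
  have h2 := Finset.sum_le_sum fun e (_ : e ∈ Finset.univ) => reaction_ge hΩ hb hc hσ (v e) e
  rw [Finset.sum_add_distrib, ← Finset.mul_sum, ← Finset.mul_sum] at h2
  linarith

/-! ### The stabilization -/

lemma stab_nonneg (p : ℕ) (kind : Fin M.numCells → SpaceKind) (b : E d → E d)
    {γ : Fin M.numCells → Broken d M.numCells → ℝ} {u : Broken d M.numCells}
    (hγ : ∀ e, γ e u ∈ Set.Icc (0 : ℝ) 1) (v : Broken d M.numCells) :
    0 ≤ M.stab p kind b γ u v v := by
  refine Finset.sum_nonneg fun e _ => ?_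
  have hν : 0 ≤ M.visc p b e :=
    div_nonneg (mul_nonneg ENNReal.toReal_nonneg Metric.diam_nonneg) (by positivity)
  refine add_nonneg (mul_nonneg (mul_nonneg (hγ e).1 hν) ?_)
    (mul_nonneg (mul_nonneg (sub_nonneg.2 (hγ e).2) hν) ?_)
  · exact integral_nonneg fun x => real_inner_self_nonneg
  · exact integral_nonneg fun x => real_inner_self_nonneg

end Mesh

end DGWeno

theorem mainTheorem7 (d p : ℕ) (hd : 1 ≤ d) (hp : 1 ≤ p) (ϱ : ℝ) (hϱ : 0 < ϱ) :
    ∃ η₀ : ℝ, 0 < η₀ ∧ ∀ η : ℝ, η₀ < η → ∃ Cη : ℝ, 0 < Cη ∧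
      ∀ (Ω : Set (DGWeno.E d)), interior (closure Ω) = Ω →
      ∀ (M : DGWeno.Mesh d Ω), M.ShapeRegular ϱ →
      ∀ (kind : Fin M.numCells → DGWeno.SpaceKind)
        (ε σ₀ : ℝ) (b : DGWeno.E d → DGWeno.E d) (c : DGWeno.E d → ℝ),
        0 < ε →
        (∀ i, DGWeno.MemW1Inf Ω (fun x => b x i)) →
        ContinuousOn b (closure Ω) →
        DGWeno.MemLInf Ω c →
        (∀ᵐ x ∂(MeasureTheory.volume.restrict Ω), 0 ≤ c x) →
        0 < σ₀ →
        (∀ᵐ x ∂(MeasureTheory.volume.restrict Ω),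
          σ₀ ≤ c x - 1 / 2 * DGWeno.weakDiv Ω b x) →
      ∀ (γ : Fin M.numCells → DGWeno.Broken d M.numCells → ℝ),
        (∀ e, ∀ u ∈ DGWeno.brokenSpace d p kind, γ e u ∈ Set.Icc (0 : ℝ) 1) →
      ∀ v ∈ DGWeno.brokenSpace d p kind, ∀ w ∈ DGWeno.brokenSpace d p kind,
        Cη * M.dgNormSq ε σ₀ v ≤ M.dgForm ε η b c v v + M.stab p kind b γ w v v := by
  obtain ⟨C, hC, htr⟩ := DGWeno.exists_trace_const d (d * p) hϱ
  refine ⟨C, hC, fun η hη => ?_⟩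
  have hηC : 0 < η + C := by linarith
  -- The Young parameter `t` satisfies `C < 1 / t < η`.
  set t : ℝ := 2 / (η + C) with ht
  have ht0 : 0 < t := by positivity
  have htC : 1 - t * C = (η - C) / (η + C) := by
    rw [ht]; field_simp; ring
  have htη : η - 1 / t = (η - C) / 2 := by
    rw [ht]; field_simp; ring
  have hα : 0 < 1 - t * C := by rw [htC]; exact div_pos (by linarith) hηC
  have hβ : 0 < η - 1 / t := by rw [htη]; linarith
  refine ⟨min (1 - t * C) (η - 1 / t), lt_min hα hβ, ?_⟩
  intro Ω hΩ M hM kind ε σ₀ b c hε hb hbc hc _ hσ₀ hσ γ hγ v hv w hw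
  set Cη : ℝ := min (1 - t * C) (η - 1 / t) with hCη
  have hv' : ∀ e, v e ∈ MvPolynomial.restrictTotalDegree (Fin d) ℝ (d * p) := fun e =>
    DGWeno.localSpace_le p hd (kind e) (hv e (Set.mem_univ e))
  have hdiff := DGWeno.Mesh.sum_faces_diffusion_le hd hΩ
    (fun e q hq => htr (M.cell e) (hM e) q hq) hv' η ht0
  have hconv := DGWeno.Mesh.convection_reaction_ge hΩ hb hbc hc hσ v
  have hstab := DGWeno.Mesh.stab_nonneg p kind b (u := w) (fun e => hγ e w hw) v
  unfold DGWeno.Mesh.dgForm DGWeno.Mesh.dgNormSq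
  simp_rw [real_inner_self_eq_norm_sq] at hdiff ⊢
  set G := ∑ e, ∫ x in M.K e, ‖DGWeno.grad (v e) x‖ ^ 2 with hG
  set J := ∑ F ∈ M.faces, 1 / M.hF F * M.faceIntegral F fun x => ‖DGWeno.Mesh.jump F v x‖ ^ 2
    with hJ
  set V := ∑ e, ∫ x in M.K e, DGWeno.val (v e) x ^ 2 with hV
  have hG0 : 0 ≤ G := Finset.sum_nonneg fun e _ => integral_nonneg fun x => sq_nonneg _
  have hV0 : 0 ≤ V := Finset.sum_nonneg fun e _ => integral_nonneg fun x => sq_nonneg _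
  have hJ0 : 0 ≤ J := Finset.sum_nonneg fun F hF =>
    mul_nonneg (one_div_nonneg.2 (DGWeno.Mesh.hF_pos hd hF).le)
      (integral_nonneg fun x => sq_nonneg _)
  have h1 : Cη * G ≤ (1 - t * C) * G := mul_le_mul_of_nonneg_right (min_le_left _ _) hG0
  have h2 : Cη * J ≤ (η - 1 / t) * J := mul_le_mul_of_nonneg_right (min_le_right _ _) hJ0
  have h3 : Cη * (σ₀ * V) ≤ σ₀ * V := by
    have hle : Cη ≤ 1 := (min_le_left _ _).trans (by have := mul_pos ht0 hC; linarith)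
    exact mul_le_of_le_one_left (mul_nonneg hσ₀.le hV0) hle
  have h4 : Cη * (G + J) ≤ G - (t * C * G - (η - 1 / t) * J) := by linarith
  have h5 := mul_le_mul_of_nonneg_left (h4.trans (sub_le_sub_left hdiff G)) hε.le
  linarith
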